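/- **Theorem 2.** Consider the following slotted first-come-first-served queue with one server, Bernoulli arrivals, general service times and vacations. In every slot $t=0,1,2,\dots$ a packet is generated with probability $\lambda>0$, independently over slots; a packet generated in slot $t$ joins the queue in time for the beginning of slot $t+1$. Service times are i.i.d. copies of a random variable $S$, and vacations are i.i.d. copies of a random variable $V$; both take values in $\{1,2,\dots\}$ (numbers of slots) and have finite second moments, and arrivals, service times and vacations are independent. At the beginning of a slot in which the server is free, it starts to serve the oldest waiting packet or, if there is none, it takes a vacation of length $V$; services and vacations are never interrupted, and services finish at the end of a slot. The queue is empty at the start. Let $\mathbb E[S]=1/\mu$ and assume $\rho=\lambda/\mu<1$. The age $A(t)$ at the beginning of slot $t$ has an arbitrary initial value $A(0)\in\{0,1,2,\dots\}$ and satisfies $A(t+1)=A(t)+1$ if no service is completed in slot $t$, and $A(t+1)=\min\{t-y,A(t)\}+1$ if the packet generated in slot $y$ completes its service in slot $t$. Define the peak age and the average age by $$A^{\mathrm p}=\limsup_{T\to\infty}\frac{\sum_{t=1}^{T}A(t)\,\mathbf 1\{A(t+1)\le A(t)\}}{\sum_{t=1}^{T}\mathbf 1\{A(t+1)\le A(t)\}},\qquad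 A^{\mathrm{ave}}=\limsup_{T\to\infty}\frac1T\sum_{t=1}^{T}A(t).$$ Then, almost surely, $$A^{\mathrm p}=\frac1\lambda+\frac1\mu+\frac{\lambda\,\mathbb E[S^2]-\rho}{2(1-\rho)}+\frac{\mathbb E[V^2]}{2\,\mathbb E[V]}-\frac12\qquad\text{and}\qquad A^{\mathrm{ave}}\le A^{\mathrm p}.$$ -/

import Mathlib

open MeasureTheory ProbabilityTheory Filter

namespace BerGV

/-- What the server is doing during a slot. In `serving y r` the packet in service was generated
in slot `y`; in `serving y r` and `vacation r`, `r` is the number of slots that the service or the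
vacation still takes, the present slot included. -/
inductive Server
  | free
  | serving (y r : ℕ)
  | vacation (r : ℕ)

/-- The state of the queueing system: the generation slots of the waiting packets, in order of
arrival, and the status of the server. -/
structure State where
  queue : List ℕ
  server : Server

/-- The decision at the beginning of slot `t`. A free server starts to serve the packet at the head
of the queue (first come first serve); if there is none, it starts a vacation. The packet generated
in slot `y` needs `S y` slots of service; a vacation that starts in slot `t` lasts `V t` slots.
A server that is serving or on vacation carries on (no preemption, and vacations are not
interrupted by arrivals). -/
def State.start (S V : ℕ → ℕ) (t : ℕ) (s : State) : State :=
  match s.server, s.queue with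
  | .free, y :: q => ⟨q, .serving y (S y)⟩
  | .free, [] => ⟨[], .vacation (V t)⟩
  | _, _ => s

/-- The status of the server at the end of a slot: a service or a vacation in its last slot ends,
and any other one has one slot less to go. -/
def Server.work : Server → Server
  | .free => .free
  | .serving y r => if r ≤ 1 then .free else .serving y (r - 1)
  | .vacation r => if r ≤ 1 then .free else .vacation (r - 1)

/-- The generation slot of the packet whose service ends with the present slot, if there is one. -/
def Server.delivered : Server → Option ℕ
  | .serving y r => if r ≤ 1 then some y else none
  | _ => none

/-- One slot of the system; `b` says whether a packet is generated in slot `t`. That packet joins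
the queue in time for the decision at the beginning of slot `t + 1`. -/
def State.step (S V : ℕ → ℕ) (t : ℕ) (b : Bool) (s : State) : State :=
  let s' := s.start S V t
  ⟨if b then s'.queue ++ [t] else s'.queue, s'.server.work⟩

/-- The state at the beginning of slot `t` (before the decision of the server); the system starts
empty. -/
def stateAt (B : ℕ → Bool) (S V : ℕ → ℕ) : ℕ → State
  | 0 => ⟨[], .free⟩
  | t + 1 => (stateAt B S V t).step S V t (B t)

/-- The generation slot of the packet whose service is completed at the end of slot `t`, if any. -/
def servedAt (B : ℕ → Bool) (S V : ℕ → ℕ) (t : ℕ) : Option ℕ :=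
  ((stateAt B S V t).start S V t).server.delivered

/-- The age `A(t)` at the beginning of slot `t`, with `A(0) = a₀`:
`A(t+1) = A(t) + 1` if no service is completed in slot `t`, and
`A(t+1) = min {t - y, A(t)} + 1` if the packet generated in slot `y` is served in slot `t`. -/
def age (B : ℕ → Bool) (S V : ℕ → ℕ) (a₀ : ℕ) : ℕ → ℕ
  | 0 => a₀
  | t + 1 =>
    match servedAt B S V t with
    | none => age B S V a₀ t + 1
    | some y => min (t - y) (age B S V a₀ t) + 1

/-- The peak age of an age process: the upper limit of the time averages of `A(t)` over the slots
with `A(t+1) ≤ A(t)`. -/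
noncomputable def peakAge (A : ℕ → ℕ) : EReal :=
  limsup (fun T : ℕ =>
    (((∑ t ∈ Finset.Icc 1 T, if A (t + 1) ≤ A t then (A t : ℝ) else 0) /
      (∑ t ∈ Finset.Icc 1 T, if A (t + 1) ≤ A t then (1 : ℝ) else 0) : ℝ) : EReal)) atTop

/-- The average age of an age process: the upper limit of its time averages. -/
noncomputable def averageAge (A : ℕ → ℕ) : EReal :=
  limsup (fun T : ℕ => (((1 / (T : ℝ)) * ∑ t ∈ Finset.Icc 1 T, (A t : ℝ) : ℝ) : EReal)) atTop

/-- The random input of the queue: in every slot a packet is generated with probability `lam`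
(`B t` says whether this happens in slot `t`); the service times `S t` are i.i.d., so are the
vacations `V t`; all of them are positive integers; and all these variables are independent. -/
structure IsInput {Ω : Type*} [MeasurableSpace Ω] (P : Measure Ω) (lam : ℝ)
    (B : ℕ → Ω → Bool) (S V : ℕ → Ω → ℕ) : Prop where
  measurable_B : ∀ t, Measurable (B t)
  measurable_S : ∀ t, Measurable (S t)
  measurable_V : ∀ t, Measurable (V t)
  prob_B : ∀ t, P.real {ω | B t ω = true} = lam
  identDistrib_S : ∀ t, IdentDistrib (S t) (S 0) P P
  identDistrib_V : ∀ t, IdentDistrib (V t) (V 0) P P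
  one_le_S : ∀ t, ∀ᵐ ω ∂P, 1 ≤ S t ω
  one_le_V : ∀ t, ∀ᵐ ω ∂P, 1 ≤ V t ω
  indep : iIndepFun (Sum.elim (fun t ω => (B t ω).toNat) (Sum.elim S V)) P

end BerGV

/-! Everything is read off the workload $W_t$ and the time $X_t$ since the last generation. Under
first come first served, a packet generated in slot $y$ leaves at the end of slot $y + W_{y+1}$, and
the age is $X_t$ plus the interarrival gaps of the undelivered packets (`age_eq`). Hence the age
just before the delivery of $y$ is $X_y + W_{y+1}$: a gap, the work found on arrival and the
packet's own service time. The gaps average to $1/\lambda$ and the services to $1/\mu$, so the peak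
age only requires the mean work found by arrivals (`peakAge_eq`).

That mean comes from regeneration at the zeros of $W$ (`ae_meanTendsto_of_cycleSum`). Balancing $W$
and $W^2$ over a cycle, and using that the arrival and the service time of a slot are independent of
the work left in it, gives linear equations whose solution is the Pollaczek–Khinchine term plus the
vacation term (`cycle_balance`). The same balances over a finite horizon first show that the cycle
means are finite.

For the average age, the sum of ages is bounded by a sum of gap times time in system. Summation by
parts with the potential $XW$ reduces it to averages of $W$, of $X_t S_t$ at arrivals, and of $X_t
V_t$ at the starts of vacations (`averageAge_le`). The last average involves the dependence between
$X$ and idleness. With $q = 1-\lambda$ and $s = \mathbb E[q^S]$, the drifts of $W$, $q^W$ and $Xq^W$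
form a closed system, which gives $(1-\rho)(q+\lambda s)/(\lambda s)$
(`meanTendsto_elapsed_mul_vacation`). Bernoulli's inequality $s \ge 1-\rho$ bounds this by
$1/\lambda-\rho$, and the bound on the average age becomes exactly the peak age.

Since $X$ is not reset at the zeros of $W$, averages involving $X$ are not cycle sums. They are
handled by a strong law for orthogonal terms (`ae_meanTendsto_mul_coord`), with a uniform bound on
the second moments of $X$. -/

namespace BerGV

/-! ### Workload, delivery times and age along a sample path -/

/-- The work left at the end of a slot, before arrivals, if `w` is the work at the beginning of the
slot and a vacation that starts in it lasts `v` slots. -/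
def afterSlot (w v : ℕ) : ℕ := w + (if w = 0 then v else 0) - 1

/-- The unfinished work (service and vacation) at the beginning of slot `t`. -/
def workload (B : ℕ → Bool) (S V : ℕ → ℕ) : ℕ → ℕ
  | 0 => 0
  | t + 1 => afterSlot (workload B S V t) (V t) + if B t then S t else 0

/-- The time elapsed since the last generation, started at `a₀`. -/
def elapsed (B : ℕ → Bool) (a₀ : ℕ) : ℕ → ℕ
  | 0 => a₀
  | t + 1 => if B t then 1 else elapsed B a₀ t + 1

/-- The slot in which a packet generated in slot `y` is delivered. -/
def delivery (B : ℕ → Bool) (S V : ℕ → ℕ) (y : ℕ) : ℕ := y + workload B S V (y + 1)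

/-- The remaining time of the service or vacation in progress. -/
def Server.remaining : Server → ℕ
  | .free => 0
  | .serving _ r => r
  | .vacation r => r

/-- The state `s` at time `t` holds the unfinished work `w`, and its packets are those generated
before `t` whose delivery, according to `C`, is still to come. -/
structure Consistent (B : ℕ → Bool) (S C : ℕ → ℕ) (t w : ℕ) (s : State) : Prop where
  work : w = s.server.remaining + (s.queue.map S).sum
  queue : ∀ l y l', s.queue = l ++ y :: l' →
    B y = true ∧ y < t ∧ C y + 1 = t + s.server.remaining + (l.map S).sum + S y
  serving : ∀ y r, s.server = .serving y r → 1 ≤ r ∧ B y = true ∧ y < t ∧ C y + 1 = t + r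
  vacation : ∀ r, s.server = .vacation r → 1 ≤ r
  complete : ∀ y < t, B y = true → t ≤ C y → y ∈ s.queue ∨ ∃ r, s.server = .serving y r

section Deterministic

variable {B : ℕ → Bool} {S V C : ℕ → ℕ} {t w : ℕ} {s : State}

/-- Work is zero only for a free server with an empty queue, since services and vacations in
progress have at least one slot to go; this is when a vacation is added. Otherwise the decision
merely moves work from the queue to the server. A server that is not free afterwards does one unit
of work in the slot. -/
lemma Consistent.start (hS : ∀ t, 1 ≤ S t) (hV : ∀ t, 1 ≤ V t) (h : Consistent B S C t w s) :
    Consistent B S C t (w + if w = 0 then V t else 0) (s.start S V t) ∧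
      (s.start S V t).server ≠ .free := by
  obtain ⟨q, sv⟩ := s
  obtain ⟨hw, hq, hs, hv, hc⟩ := h
  simp only at hw hq hs hv hc
  cases sv with
  | free =>
    cases q with
    | nil =>
      simp only [Server.remaining, List.map_nil, List.sum_nil] at hw
      subst hw
      refine ⟨⟨by simp [State.start, Server.remaining], by simp [State.start],
        by simp [State.start], ?_, ?_⟩, by simp [State.start]⟩
      · rintro r hr
        simp only [State.start, Server.vacation.injEq] at hr
        exact hr ▸ hV t
      · intro y hy hB hC
        simpa using hc y hy hB hC
    | cons y q =>
      simp only [Server.remaining, List.map_cons, List.sum_cons] at hw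
      have hy := hS y
      have hw0 : w ≠ 0 := by omega
      have h0 := hq [] y q rfl
      simp only [Server.remaining, List.map_nil, List.sum_nil] at h0
      refine ⟨⟨?_, ?_, ?_, by simp [State.start], ?_⟩, by simp [State.start]⟩
      · simp only [State.start, Server.remaining, if_neg hw0]; omega
      · intro l y' l' hl
        simp only [State.start] at hl
        have := hq (y :: l) y' l' (by rw [hl]; rfl)
        simp only [Server.remaining, List.map_cons, List.sum_cons] at this
        simp only [State.start, Server.remaining]
        exact ⟨this.1, this.2.1, by omega⟩
      · intro y' r hr
        simp only [State.start, Server.serving.injEq] at hr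
        obtain ⟨rfl, rfl⟩ := hr
        exact ⟨hy, h0.1, h0.2.1, by omega⟩
      · intro y' hy' hB hC
        simp only [State.start, Server.serving.injEq]
        rcases hc y' hy' hB hC with h | ⟨r, h⟩
        · rcases List.mem_cons.1 h with rfl | h
          · exact .inr ⟨_, rfl, rfl⟩
          · exact .inl h
        · simp at h
  | serving y r =>
    have := (hs y r rfl).1
    have hw0 : w ≠ 0 := by simp only [Server.remaining] at hw; omega
    rw [if_neg hw0, add_zero]
    exact ⟨⟨hw, hq, hs, hv, hc⟩, by simp [State.start]⟩
  | vacation r =>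
    have := hv r rfl
    have hw0 : w ≠ 0 := by simp only [Server.remaining] at hw; omega
    rw [if_neg hw0, add_zero]
    exact ⟨⟨hw, hq, hs, hv, hc⟩, by simp [State.start]⟩

lemma Server.remaining_work (sv : Server) : sv.work.remaining = sv.remaining - 1 := by
  cases sv with
  | free => rfl
  | serving y r =>
    simp only [Server.work]
    split
    · simp only [Server.remaining]
      omega
    · rfl
  | vacation r =>
    simp only [Server.work]
    split
    · simp only [Server.remaining]
      omega
    · rfl

lemma Consistent.one_le_remaining (h : Consistent B S C t w s) (hf : s.server ≠ .free) :
    1 ≤ s.server.remaining := by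
  cases hsv : s.server with
  | free => exact absurd hsv hf
  | serving y r => exact (h.serving y r hsv).1
  | vacation r => exact h.vacation r hsv

/-- The hypothesis `hC` is first come first served: a packet generated in slot `t` has `w - 1` units
of work ahead of it, and later packets never delay it. -/
lemma Consistent.work_step (hC : B t = true → C t = t + (w - 1 + S t))
    (h : Consistent B S C t w s) (hf : s.server ≠ .free) :
    Consistent B S C (t + 1) (w - 1 + if B t then S t else 0)
      ⟨if B t then s.queue ++ [t] else s.queue, s.server.work⟩ := by
  have h1 := h.one_le_remaining hf
  have hw := h.work
  refine ⟨?_, ?_, ?_, ?_, ?_⟩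
  · simp only [Server.remaining_work]
    split <;> simp <;> omega
  · have key : ∀ l y l', s.queue = l ++ y :: l' → B y = true ∧ y < t + 1 ∧
        C y + 1 = t + 1 + s.server.work.remaining + (l.map S).sum + S y := by
      intro l y l' hl
      obtain ⟨a, b, c⟩ := h.queue l y l' hl
      exact ⟨a, by omega, by rw [Server.remaining_work]; omega⟩
    intro l y l' hl
    simp only at hl
    split_ifs at hl with hb
    · rcases List.eq_nil_or_concat l' with rfl | ⟨l'', z, rfl⟩
      · obtain ⟨rfl, h2⟩ := List.append_inj' hl rfl
        obtain rfl : t = y := by simpa using h2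
        simp only [Server.remaining_work]
        exact ⟨hb, by omega, by rw [hC hb]; omega⟩
      · have h3 : s.queue ++ [t] = (l ++ y :: l'') ++ [z] := by rw [hl]; simp
        exact key l y l'' (List.append_inj' h3 rfl).1
    · exact key l y l' hl
  · intro y r hr
    cases hsv : s.server with
    | free => exact absurd hsv hf
    | serving y' r' =>
      simp only [hsv, Server.work] at hr
      obtain ⟨a, b, c, d⟩ := h.serving y' r' hsv
      split_ifs at hr with h2
      simp only [Server.serving.injEq] at hr
      obtain ⟨rfl, rfl⟩ := hr
      exact ⟨by omega, b, by omega, by omega⟩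
    | vacation r' =>
      simp only [hsv, Server.work] at hr
      split_ifs at hr
  · intro r hr
    cases hsv : s.server with
    | free => exact absurd hsv hf
    | serving y' r' =>
      simp only [hsv, Server.work] at hr
      split_ifs at hr
    | vacation r' =>
      simp only [hsv, Server.work] at hr
      split_ifs at hr with h2
      simp only [Server.vacation.injEq] at hr
      omega
  · intro y hy hB hle
    rcases Nat.lt_succ_iff_lt_or_eq.1 hy with hy | rfl
    · rcases h.complete y hy hB (by omega) with h2 | ⟨r, h2⟩
      · left
        simp only
        split_ifs
        · exact List.mem_append_left _ h2
        · exact h2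
      · right
        have := h.serving y r h2
        refine ⟨r - 1, ?_⟩
        simp only [h2, Server.work]
        rw [if_neg (by omega)]
    · left
      simp only [hB, if_true]
      simp

lemma stateAt_consistent (hS : ∀ t, 1 ≤ S t) (hV : ∀ t, 1 ≤ V t) (t : ℕ) :
    Consistent B S (delivery B S V) t (workload B S V t) (stateAt B S V t) := by
  induction t with
  | zero => exact ⟨rfl, by simp [stateAt], by simp [stateAt], by simp [stateAt], by simp⟩
  | succ t ih =>
    obtain ⟨h, hf⟩ := ih.start hS hV
    refine h.work_step ?_ hf
    intro hb
    simp [delivery, workload, hb, afterSlot]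

/-- Vacations last at least one slot, so the truncated subtraction in `afterSlot` loses nothing. -/
lemma workload_succ_add_one (hV : ∀ t, 1 ≤ V t) (t : ℕ) :
    afterSlot (workload B S V t) (V t) + 1 =
      workload B S V t + if workload B S V t = 0 then V t else 0 := by
  have := hV t
  unfold afterSlot
  split <;> omega

/-- The workload drops by at most one per slot, so `y + W (y + 1)` cannot decrease. Monotonicity is
wanted for all slots, with or without a packet, to enumerate deliveries. -/
lemma delivery_mono (hV : ∀ t, 1 ≤ V t) : Monotone (delivery B S V) := by
  refine monotone_nat_of_le_succ fun y => ?_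
  have := workload_succ_add_one (B := B) (S := S) hV (y + 1)
  have h1 : workload B S V (y + 1 + 1) = afterSlot (workload B S V (y + 1)) (V (y + 1)) +
      if B (y + 1) then S (y + 1) else 0 := rfl
  unfold delivery
  omega

/-- A packet generated in `y'` adds at least one unit of work, so the inequality is strict there. -/
lemma delivery_lt_delivery (hS : ∀ t, 1 ≤ S t) (hV : ∀ t, 1 ≤ V t) {y y' : ℕ} (h : y < y')
    (hB : B y' = true) : delivery B S V y < delivery B S V y' := by
  obtain ⟨y', rfl⟩ : ∃ k, y' = k + 1 := ⟨y' - 1, by omega⟩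
  refine (delivery_mono hV (show y ≤ y' by omega)).trans_lt ?_
  have := workload_succ_add_one (B := B) (S := S) hV (y' + 1)
  have h1 := hS (y' + 1)
  have h2 : workload B S V (y' + 1 + 1) = afterSlot (workload B S V (y' + 1)) (V (y' + 1)) +
      if B (y' + 1) then S (y' + 1) else 0 := rfl
  rw [if_pos hB] at h2
  unfold delivery
  omega

lemma lt_delivery (hS : ∀ t, 1 ≤ S t) {y : ℕ} (hB : B y = true) : y < delivery B S V y := by
  have h1 := hS y
  unfold delivery
  rw [workload, if_pos hB]
  omega

lemma le_delivery (y : ℕ) : y ≤ delivery B S V y := Nat.le_add_right _ _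

lemma servedAt_eq_some_iff (hS : ∀ t, 1 ≤ S t) (hV : ∀ t, 1 ≤ V t) {t y : ℕ} :
    servedAt B S V t = some y ↔ B y = true ∧ delivery B S V y = t := by
  obtain ⟨h, hf⟩ := (stateAt_consistent (B := B) hS hV t).start hS hV
  have h1 := h.one_le_remaining hf
  unfold servedAt
  constructor
  · intro hd
    cases hsv : ((stateAt B S V t).start S V t).server with
    | free => exact absurd hsv hf
    | serving y' r =>
      simp only [hsv, Server.delivered] at hd
      split_ifs at hd with hr
      obtain rfl : y' = y := by simpa using hd
      have := h.serving y' r hsv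
      exact ⟨this.2.1, by omega⟩
    | vacation r => simp [hsv, Server.delivered] at hd
  · rintro ⟨hB, hd⟩
    have hlt : y < t := hd ▸ lt_delivery hS hB
    rcases h.complete y hlt hB hd.ge with h2 | ⟨r, h2⟩
    · obtain ⟨l, l', h3⟩ := List.append_of_mem h2
      have := h.queue l y l' h3
      have := hS y
      omega
    · have := h.serving y r h2
      rw [h2, Server.delivered, if_pos (by omega)]

/-- The generations before `t` not delivered before `t`. -/
def pending (B : ℕ → Bool) (S V : ℕ → ℕ) (t : ℕ) : Finset ℕ :=
  (Finset.range t).filter fun y => B y = true ∧ t ≤ delivery B S V y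

/-- First come first served: when `y` leaves, all older packets have left and all younger ones are
still present. -/
lemma pending_delivery (hS : ∀ t, 1 ≤ S t) (hV : ∀ t, 1 ≤ V t) {t y : ℕ} (hB : B y = true)
    (hdy : delivery B S V y = t) : pending B S V t =
      insert y ((Finset.Ico (y + 1) (y + 1 + (t - y - 1))).filter fun z => B z = true) := by
  have hlt : y < t := hdy ▸ lt_delivery hS hB
  ext z
  simp only [pending, Finset.mem_filter, Finset.mem_range, Finset.mem_insert, Finset.mem_Ico]
  constructor
  · rintro ⟨h1, h2, h3⟩
    rcases lt_trichotomy z y with h | h | h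
    · have := delivery_lt_delivery (B := B) hS hV h hB
      omega
    · exact .inl h
    · exact .inr ⟨by omega, h2⟩
  · rintro (rfl | ⟨h1, h2⟩)
    · exact ⟨hlt, hB, hdy.ge⟩
    · have := delivery_lt_delivery (B := B) hS hV (show y < z by omega) h2
      exact ⟨by omega, h2, by omega⟩

/-- At a generation slot `z`, `elapsed` is the gap to the previous generation; the gaps after `y`
and the current elapsed time tile the time since `y`. -/
lemma elapsed_add_sum_Ico {a₀ : ℕ} {y : ℕ} (hB : B y = true) (k : ℕ) :
    elapsed B a₀ (y + 1 + k) +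
      ∑ z ∈ (Finset.Ico (y + 1) (y + 1 + k)).filter (fun z => B z = true), elapsed B a₀ z =
      k + 1 := by
  induction k with
  | zero => simp [elapsed, hB]
  | succ k ih =>
    rw [← add_assoc, Finset.sum_filter, Finset.sum_Ico_succ_top (by omega), ← Finset.sum_filter,
      elapsed]
    split_ifs with h <;> omega

/-- Without a delivery both sides grow by one: a generation in slot `t` only turns the elapsed time
into the gap of a new pending packet. A delivery of `y` removes the gap of `y`. -/
lemma age_eq (hS : ∀ t, 1 ≤ S t) (hV : ∀ t, 1 ≤ V t) (a₀ t : ℕ) :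
    age B S V a₀ t = elapsed B a₀ t + ∑ y ∈ pending B S V t, elapsed B a₀ y := by
  induction t with
  | zero => simp [age, elapsed, pending]
  | succ t ih =>
    have hsucc : elapsed B a₀ (t + 1) + (if B t then elapsed B a₀ t else 0) =
        elapsed B a₀ t + 1 := by
      rw [elapsed]; split_ifs <;> omega
    have hnew : B t = true → t + 1 ≤ delivery B S V t := fun h => lt_delivery hS h
    have hpend : pending B S V (t + 1) =
        (if B t then insert t ((pending B S V t).filter fun y => delivery B S V y ≠ t)
          else (pending B S V t).filter fun y => delivery B S V y ≠ t) := by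
      ext y
      by_cases hb : B t = true
      · simp only [hb, if_true, pending, Finset.mem_filter, Finset.mem_range, Finset.mem_insert]
        constructor
        · rintro ⟨h1, h2, h3⟩
          by_cases hy : y = t
          · exact .inl hy
          · exact .inr ⟨⟨by omega, h2, by omega⟩, by omega⟩
        · rintro (rfl | ⟨⟨h1, h2, h3⟩, h4⟩)
          · exact ⟨by omega, hb, hnew hb⟩
          · exact ⟨by omega, h2, by omega⟩
      · simp only [if_neg hb, pending, Finset.mem_filter, Finset.mem_range]
        constructor
        · rintro ⟨h1, h2, h3⟩
          have : y ≠ t := fun h => hb (h ▸ h2)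
          exact ⟨⟨by omega, h2, by omega⟩, by omega⟩
        · rintro ⟨⟨h1, h2, h3⟩, h4⟩
          exact ⟨by omega, h2, by omega⟩
    have hnm : t ∉ (pending B S V t).filter fun y => delivery B S V y ≠ t := by
      simp [pending]
    have hsum : elapsed B a₀ (t + 1) + ∑ y ∈ pending B S V (t + 1), elapsed B a₀ y =
        elapsed B a₀ t + 1 +
          ∑ y ∈ (pending B S V t).filter (fun y => delivery B S V y ≠ t), elapsed B a₀ y := by
      rw [hpend]
      split_ifs with hb
      · rw [Finset.sum_insert hnm]
        rw [if_pos hb] at hsucc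
        omega
      · rw [if_neg hb] at hsucc
        omega
    rw [hsum, age]
    cases hd : servedAt B S V t with
    | none =>
      simp only
      rw [Finset.filter_true_of_mem, ih]
      · omega
      · intro y hy hdy
        simp only [pending, Finset.mem_filter] at hy
        have := (servedAt_eq_some_iff hS hV).2 ⟨hy.2.1, hdy⟩
        rw [hd] at this
        cases this
    | some y =>
      simp only
      obtain ⟨hB, hdy⟩ := (servedAt_eq_some_iff hS hV).1 hd
      have hlt : y < t := hdy ▸ lt_delivery hS hB
      have hset := pending_delivery hS hV hB hdy
      have hfil : (pending B S V t).filter (fun z => delivery B S V z ≠ t) =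
          (Finset.Ico (y + 1) (y + 1 + (t - y - 1))).filter fun z => B z = true := by
        rw [hset, Finset.filter_insert, if_neg (by simpa using hdy), Finset.filter_true_of_mem]
        intro z hz
        simp only [Finset.mem_filter, Finset.mem_Ico] at hz
        have := delivery_lt_delivery (B := B) hS hV (show y < z by omega) hz.2
        omega
      -- This identity equates `t - y` with the age at `t` minus the gap of `y`, so the minimum in
      -- the recursion is always `t - y`.
      have hIco := elapsed_add_sum_Ico (a₀ := a₀) hB (t - y - 1)
      rw [hfil, ih, hset, Finset.sum_insert (by simp)]
      rw [show y + 1 + (t - y - 1) = t by omega] at hIco ⊢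
      omega

/-- The age just before a delivery. -/
lemma age_delivery (hS : ∀ t, 1 ≤ S t) (hV : ∀ t, 1 ≤ V t) (a₀ : ℕ) {y : ℕ} (hB : B y = true) :
    age B S V a₀ (delivery B S V y) = elapsed B a₀ y + workload B S V (y + 1) ∧
    age B S V a₀ (delivery B S V y + 1) = workload B S V (y + 1) + 1 := by
  have hlt := lt_delivery (V := V) hS hB
  have hd := (servedAt_eq_some_iff (B := B) (S := S) (V := V) hS hV).2 ⟨hB, rfl⟩
  have h1 : age B S V a₀ (delivery B S V y) = elapsed B a₀ y + workload B S V (y + 1) := by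
    rw [age_eq hS hV]
    set t := delivery B S V y with ht
    have hset := pending_delivery (t := t) hS hV hB rfl
    have hIco := elapsed_add_sum_Ico (a₀ := a₀) hB (t - y - 1)
    rw [hset, Finset.sum_insert (by simp)]
    rw [show y + 1 + (t - y - 1) = t by omega] at hIco ⊢
    have : t = y + workload B S V (y + 1) := rfl
    omega
  refine ⟨h1, ?_⟩
  rw [age, hd]
  simp only [h1]
  unfold delivery
  omega

end Deterministic

end BerGV

/-! ### Averages over initial segments -/

namespace BerGV

open Topology

/-- The averages of `f` over initial segments converge to `l`. -/
def MeanTendsto (f : ℕ → ℝ) (l : ℝ) : Prop :=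
  Tendsto (fun n : ℕ => (∑ t ∈ Finset.range n, f t) / (n : ℝ)) atTop (𝓝 l)

namespace MeanTendsto

variable {f g : ℕ → ℝ} {a b : ℝ}

lemma add (hf : MeanTendsto f a) (hg : MeanTendsto g b) :
    MeanTendsto (fun t => f t + g t) (a + b) := by
  refine (Tendsto.add hf hg).congr fun n => ?_
  rw [Finset.sum_add_distrib, add_div]

lemma const_mul (c : ℝ) (hf : MeanTendsto f a) : MeanTendsto (fun t => c * f t) (c * a) := by
  refine (Tendsto.const_mul c hf).congr fun n => ?_
  rw [← Finset.mul_sum, mul_div_assoc]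

lemma sub (hf : MeanTendsto f a) (hg : MeanTendsto g b) :
    MeanTendsto (fun t => f t - g t) (a - b) := by
  refine (Tendsto.sub hf hg).congr fun n => ?_
  rw [Finset.sum_sub_distrib, sub_div]

lemma const (c : ℝ) : MeanTendsto (fun _ => c) c := by
  refine tendsto_const_nhds.congr' ?_
  filter_upwards [eventually_gt_atTop 0] with n hn
  have : (n : ℝ) ≠ 0 := by positivity
  simp [this]

lemma congr (hf : MeanTendsto f a) (h : ∀ t, f t = g t) : MeanTendsto g a := by
  rwa [← funext h]

lemma tendsto_div (hf : MeanTendsto f a) : Tendsto (fun n : ℕ => f n / (n : ℝ)) atTop (𝓝 0) := by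
  have h1 : Tendsto (fun n : ℕ => ((n : ℝ) + 1) / (n : ℝ)) atTop (𝓝 1) := by
    have := (tendsto_const_div_atTop_nhds_zero_nat (1 : ℝ)).const_add 1
    rw [add_zero] at this
    refine this.congr' ?_
    filter_upwards [eventually_gt_atTop 0] with n hn
    have : (n : ℝ) ≠ 0 := by positivity
    field_simp
  have h2 := ((hf.comp (tendsto_add_atTop_nat 1)).mul h1).sub hf
  rw [mul_one, sub_self] at h2
  refine h2.congr' ?_
  filter_upwards [eventually_gt_atTop 0] with n hn
  have h3 : (n : ℝ) ≠ 0 := by positivity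
  have h4 : (n : ℝ) + 1 ≠ 0 := by positivity
  simp only [Function.comp_apply, Finset.sum_range_succ]
  push_cast
  field_simp
  ring

lemma sum_succ (f : ℕ → ℝ) (n : ℕ) :
    ∑ t ∈ Finset.range n, f (t + 1) = ∑ t ∈ Finset.range n, f t + f n - f 0 := by
  have h1 := Finset.sum_range_succ f n
  rw [Finset.sum_range_succ'] at h1
  linarith

lemma succ (hf : MeanTendsto f a) : MeanTendsto (fun t => f (t + 1)) a := by
  have := (Tendsto.add hf hf.tendsto_div).sub (tendsto_const_div_atTop_nhds_zero_nat (f 0))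
  rw [add_zero, sub_zero] at this
  refine this.congr fun n => ?_
  rw [sum_succ, ← add_div, ← sub_div]

/-- A telescoping sum whose potential is sublinear has vanishing averages. -/
lemma of_potential (hf : Tendsto (fun n : ℕ => f n / (n : ℝ)) atTop (𝓝 0)) :
    MeanTendsto (fun t => f (t + 1) - f t) 0 := by
  have := hf.sub (tendsto_const_div_atTop_nhds_zero_nat (f 0))
  rw [sub_zero] at this
  refine this.congr fun n => ?_
  rw [Finset.sum_range_sub, sub_div]

/-- Slot 0 is exceptional below: if `a₀ = 0`, a packet generated there has gap 0. -/
lemma congr_of_succ (hf : MeanTendsto f a) (h : ∀ t, f (t + 1) = g (t + 1)) :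
    MeanTendsto g a := by
  have h2 := hf.add (of_potential (f := fun t => if t = 0 then f 0 - g 0 else 0) (by
    refine tendsto_const_nhds.congr' ?_
    filter_upwards [eventually_gt_atTop 0] with n hn
    simp [hn.ne']))
  rw [add_zero] at h2
  refine h2.congr fun t => ?_
  cases t with
  | zero => simp
  | succ t => simp [h]

end MeanTendsto

/-! ### Peak age and average age in terms of time averages -/

variable {B : ℕ → Bool} {S V : ℕ → ℕ}

/-- A delivery of `y` changes the age from `elapsed B a₀ y + W` to `W + 1`, where `W` is the
workload at `y + 1`; this fails to be a drop only for gap 0. -/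
lemma age_succ_le_iff (hS : ∀ t, 1 ≤ S t) (hV : ∀ t, 1 ≤ V t) (a₀ t : ℕ) :
    age B S V a₀ (t + 1) ≤ age B S V a₀ t ↔
      ∃ y, B y = true ∧ 0 < elapsed B a₀ y ∧ delivery B S V y = t := by
  constructor
  · intro h
    cases hd : servedAt B S V t with
    | none =>
      rw [age, hd] at h
      simp at h
    | some y =>
      obtain ⟨hB, rfl⟩ := (servedAt_eq_some_iff hS hV).1 hd
      have := age_delivery (V := V) hS hV a₀ hB
      exact ⟨y, hB, by omega, rfl⟩
  · rintro ⟨y, hB, hX, rfl⟩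
    have := age_delivery (V := V) hS hV a₀ hB
    omega

/-- Sums over the delivery slots up to `T` are sums over an initial segment of the generation
slots, whose length tends to infinity with `T`. -/
lemma exists_sum_peaks (hS : ∀ t, 1 ≤ S t) (hV : ∀ t, 1 ≤ V t) (a₀ : ℕ) :
    ∃ N : ℕ → ℕ, Tendsto N atTop atTop ∧ ∀ (f : ℕ → ℝ) (T : ℕ),
      (∑ t ∈ Finset.Icc 1 T, if age B S V a₀ (t + 1) ≤ age B S V a₀ t then f t else 0) =
      ∑ y ∈ Finset.range (N T),
        if B y = true ∧ 0 < elapsed B a₀ y then f (delivery B S V y) else 0 := by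
  have hex : ∀ T, ∃ n, T < delivery B S V n := fun T => ⟨T + 1, le_delivery (T + 1)⟩
  -- `N T` is the first slot whose `delivery` exceeds `T`; by monotonicity the slots below it are
  -- exactly those with delivery at most `T`.
  have hN : ∀ T y, y < Nat.find (hex T) ↔ delivery B S V y ≤ T := by
    intro T y
    constructor
    · intro h
      exact not_lt.1 (Nat.find_min (hex T) h)
    · intro h
      by_contra h2
      have h3 := delivery_mono (B := B) (S := S) hV (not_lt.1 h2)
      have h4 := Nat.find_spec (hex T)
      omega
  refine ⟨fun T => Nat.find (hex T), ?_, ?_⟩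
  · refine tendsto_atTop.2 fun k => ?_
    filter_upwards [eventually_ge_atTop (delivery B S V k)] with T hT
    exact ((hN T k).2 hT).le
  · intro f T
    rw [← Finset.sum_filter, ← Finset.sum_filter]
    symm
    refine Finset.sum_bij (fun y _ => delivery B S V y) ?_ ?_ ?_ ?_
    · intro y hy
      simp only [Finset.mem_filter, Finset.mem_range, hN] at hy
      simp only [Finset.mem_filter, Finset.mem_Icc]
      have := lt_delivery (V := V) hS hy.2.1
      exact ⟨⟨by omega, hy.1⟩, (age_succ_le_iff hS hV _ _).2 ⟨y, hy.2.1, hy.2.2, rfl⟩⟩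
    · intro y hy y' hy' h
      simp only [Finset.mem_filter, Finset.mem_range, hN] at hy hy'
      rcases lt_trichotomy y y' with h2 | h2 | h2
      · have := delivery_lt_delivery (B := B) hS hV h2 hy'.2.1
        omega
      · exact h2
      · have := delivery_lt_delivery (B := B) hS hV h2 hy.2.1
        omega
    · intro t ht
      simp only [Finset.mem_filter, Finset.mem_Icc] at ht
      obtain ⟨y, hB, hX, hd⟩ := (age_succ_le_iff hS hV _ _).1 ht.2
      refine ⟨y, ?_, hd⟩
      simp only [Finset.mem_filter, Finset.mem_range, hN]
      exact ⟨by omega, hB, hX⟩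
    · intro y _
      rfl

lemma elapsed_succ_pos (B : ℕ → Bool) (a₀ t : ℕ) : 0 < elapsed B a₀ (t + 1) := by
  rw [elapsed]; split_ifs <;> omega

/-- After reindexing by generation slots, the peak age is a quotient of two averages: gap plus work
found plus service time over arrivals, divided by the arrival rate. -/
theorem peakAge_eq (hS : ∀ t, 1 ≤ S t) (hV : ∀ t, 1 ≤ V t) (a₀ : ℕ) {lam r y : ℝ}
    (hlam : 0 < lam) (hB : MeanTendsto (fun t => if B t then 1 else 0) lam)
    (hBS : MeanTendsto (fun t => if B t then (S t : ℝ) else 0) r)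
    (hBY : MeanTendsto (fun t =>
      if B t then (afterSlot (workload B S V t) (V t) : ℝ) else 0) (lam * y))
    (hX : Tendsto (fun n : ℕ => (elapsed B a₀ n : ℝ) / n) atTop (𝓝 0)) :
    peakAge (age B S V a₀) = ((1 / lam + y + r / lam : ℝ) : EReal) := by
  obtain ⟨N, hN, hsum⟩ := exists_sum_peaks (B := B) hS hV a₀
  -- The drift of the elapsed time is one minus its value at generations, so the gaps summed over
  -- arrivals fill all of time.
  have hBX : MeanTendsto (fun t => if B t then (elapsed B a₀ t : ℝ) else 0) 1 := by
    have := (MeanTendsto.const 1).sub (MeanTendsto.of_potential hX)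
    rw [sub_zero] at this
    refine this.congr fun t => ?_
    rw [elapsed]
    split_ifs <;> push_cast <;> ring
  have hden : MeanTendsto (fun t => if B t = true ∧ 0 < elapsed B a₀ t then (1 : ℝ) else 0)
      lam := by
    refine hB.congr_of_succ fun t => ?_
    simp [elapsed_succ_pos]
  have hnum : MeanTendsto (fun t => if B t = true ∧ 0 < elapsed B a₀ t then
      (age B S V a₀ (delivery B S V t) : ℝ) else 0) (1 + lam * y + r) := by
    refine ((hBX.add hBY).add hBS).congr_of_succ fun t => ?_
    by_cases hb : B (t + 1) = true
    · simp only [hb, elapsed_succ_pos, and_self, if_true]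
      rw [(age_delivery hS hV a₀ hb).1,
        show workload B S V (t + 1 + 1) = afterSlot (workload B S V (t + 1)) (V (t + 1)) +
          if B (t + 1) then S (t + 1) else 0 from rfl, if_pos hb]
      push_cast
      ring
    · simp [hb]
  have hlim := ((Tendsto.div hnum hden hlam.ne').comp hN)
  unfold peakAge
  refine Tendsto.limsup_eq ?_
  rw [show 1 / lam + y + r / lam = (1 + lam * y + r) / lam by field_simp]
  refine (continuous_coe_real_ereal.tendsto _).comp (hlim.congr' ?_)
  filter_upwards [hN.eventually_gt_atTop 0] with T hT
  have h0 : (N T : ℝ) ≠ 0 := by positivity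
  simp only [Function.comp_apply, Pi.div_apply]
  rw [hsum (fun t => (age B S V a₀ t : ℝ)), hsum (fun _ => 1), div_div_div_cancel_right₀ h0]

/-- Double counting: the gap of `y` enters the age in the slots from `y + 1` to its delivery, which
are `W (y + 1)` in number. Cutting at `T` only loses slots. -/
lemma sum_age_le (hS : ∀ t, 1 ≤ S t) (hV : ∀ t, 1 ≤ V t) (a₀ T : ℕ) :
    ∑ t ∈ Finset.Icc 1 T, age B S V a₀ t ≤ ∑ t ∈ Finset.Icc 1 T, elapsed B a₀ t +
      ∑ y ∈ Finset.range T, if B y then elapsed B a₀ y * workload B S V (y + 1) else 0 := by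
  simp_rw [age_eq hS hV]
  rw [Finset.sum_add_distrib]
  refine Nat.add_le_add_left ?_ _
  have h1 : ∀ t ∈ Finset.Icc 1 T, ∑ y ∈ pending B S V t, elapsed B a₀ y =
      ∑ y ∈ Finset.range T, if y < t ∧ B y = true ∧ t ≤ delivery B S V y
        then elapsed B a₀ y else 0 := by
    intro t ht
    simp only [Finset.mem_Icc] at ht
    rw [← Finset.sum_filter]
    refine Finset.sum_congr ?_ fun _ _ => rfl
    ext y
    simp only [pending, Finset.mem_filter, Finset.mem_range]
    constructor
    · rintro ⟨h1, h2⟩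
      exact ⟨by omega, h1, h2⟩
    · rintro ⟨-, h⟩
      exact h
  rw [Finset.sum_congr rfl h1, Finset.sum_comm]
  refine Finset.sum_le_sum fun y _ => ?_
  split_ifs with hb
  · rw [← Finset.sum_filter, Finset.sum_const, smul_eq_mul, mul_comm]
    refine Nat.mul_le_mul_left _ ?_
    have : (Finset.Icc 1 T).filter (fun t => y < t ∧ B y = true ∧ t ≤ delivery B S V y) ⊆
        Finset.Ioc y (delivery B S V y) := by
      intro t
      simp only [Finset.mem_filter, Finset.mem_Ioc]
      tauto
    refine (Finset.card_le_card this).trans ?_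
    rw [Nat.card_Ioc]
    unfold delivery
    omega
  · simp [hb]

/-- Summation by parts with the potential elapsed time times workload. It trades the products at
arrivals for workloads and for elapsed times at the starts of vacations; the sum of elapsed times on
the left cancels the one in `sum_age_le`. -/
lemma sum_elapsed_mul_afterSlot (hV : ∀ t, 1 ≤ V t) (a₀ T : ℕ) :
    ∑ t ∈ Finset.range T, (if B t then elapsed B a₀ t * afterSlot (workload B S V t) (V t) else 0)
      + elapsed B a₀ T * workload B S V T + ∑ t ∈ Finset.range T, elapsed B a₀ t =
    ∑ t ∈ Finset.range T,
      (elapsed B a₀ t * (if workload B S V t = 0 then V t else 0) + workload B S V (t + 1)) := by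
  induction T with
  | zero => simp [workload]
  | succ T ih =>
    have h1 := workload_succ_add_one (B := B) (S := S) hV T
    have h2 : elapsed B a₀ (T + 1) * workload B S V (T + 1) +
        (if B T then elapsed B a₀ T * afterSlot (workload B S V T) (V T) else 0) =
        elapsed B a₀ T * afterSlot (workload B S V T) (V T) + workload B S V (T + 1) := by
      rw [elapsed, workload]
      split_ifs <;> ring
    have h3 : elapsed B a₀ T * afterSlot (workload B S V T) (V T) + elapsed B a₀ T =
        elapsed B a₀ T * workload B S V T +
          elapsed B a₀ T * if workload B S V T = 0 then V T else 0 := by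
      rw [← mul_add, ← h1]; ring
    rw [Finset.sum_range_succ, Finset.sum_range_succ, Finset.sum_range_succ, ← ih]
    omega

/-- Only an upper bound: the nonnegative boundary terms of the two preceding identities are dropped.
The remaining elapsed time at `T` is sublinear. -/
theorem averageAge_le (hS : ∀ t, 1 ≤ S t) (hV : ∀ t, 1 ≤ V t) (a₀ : ℕ) {z s c : ℝ}
    (hW : MeanTendsto (fun t => (workload B S V t : ℝ)) z)
    (hX : Tendsto (fun n : ℕ => (elapsed B a₀ n : ℝ) / n) atTop (𝓝 0))
    (hBXS : MeanTendsto (fun t => if B t then (elapsed B a₀ t : ℝ) * S t else 0) s)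
    (hXV : MeanTendsto (fun t =>
      (elapsed B a₀ t : ℝ) * if workload B S V t = 0 then (V t : ℝ) else 0) c) :
    averageAge (age B S V a₀) ≤ ((c + z + s : ℝ) : EReal) := by
  have h1 := (((hXV.add hW.succ).add hBXS).add (MeanTendsto.of_potential hX))
  rw [add_zero] at h1
  rw [← ((continuous_coe_real_ereal.tendsto _).comp h1).limsup_eq]
  refine limsup_le_limsup (Eventually.of_forall fun T => ?_)
  simp only [Function.comp_apply]
  rw [EReal.coe_le_coe_iff, one_div_mul_eq_div]
  refine div_le_div_of_nonneg_right ?_ (Nat.cast_nonneg T)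
  have h2 := sum_age_le (B := B) hS hV a₀ T
  have h3 := sum_elapsed_mul_afterSlot (B := B) (S := S) hV a₀ T
  have h4 : (∑ y ∈ Finset.range T, if B y then elapsed B a₀ y * workload B S V (y + 1) else 0) =
      ∑ t ∈ Finset.range T,
        (if B t then elapsed B a₀ t * afterSlot (workload B S V t) (V t) else 0) +
      ∑ t ∈ Finset.range T, if B t then elapsed B a₀ t * S t else 0 := by
    rw [← Finset.sum_add_distrib]
    refine Finset.sum_congr rfl fun t _ => ?_
    rw [workload]
    split_ifs <;> ring
  have h5 : ∑ t ∈ Finset.Icc 1 T, elapsed B a₀ t + elapsed B a₀ 0 =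
      ∑ t ∈ Finset.range T, elapsed B a₀ t + elapsed B a₀ T := by
    rw [← Finset.sum_range_succ, Finset.range_eq_Ico, Finset.sum_eq_sum_Ico_succ_bot (by omega)]
    rw [add_comm]
    rfl
  have h6 : ∑ t ∈ Finset.Icc 1 T, age B S V a₀ t + elapsed B a₀ 0 ≤
      ∑ t ∈ Finset.range T, (elapsed B a₀ t * (if workload B S V t = 0 then V t else 0) +
        workload B S V (t + 1)) + elapsed B a₀ T +
        ∑ t ∈ Finset.range T, if B t then elapsed B a₀ t * S t else 0 := by
    omega
  have h7 : ((∑ t ∈ Finset.Icc 1 T, age B S V a₀ t + elapsed B a₀ 0 : ℕ) : ℝ) ≤ _ :=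
    Nat.cast_le.2 h6
  push_cast at h7
  rw [Finset.sum_add_distrib, Finset.sum_add_distrib, Finset.sum_range_sub
    (fun t => (elapsed B a₀ t : ℝ))]
  linarith

end BerGV

/-! ### A strong law for orthogonal random variables -/

namespace BerGV

open Topology

section Orthogonal

variable {Ω : Type*} [MeasurableSpace Ω] {P : Measure Ω}

/-- The second moments are summable, so the sum of the squares has finite expectation and is almost
surely finite. -/
lemma ae_tendsto_zero_of_integral_sq_le {f : ℕ → Ω → ℝ} (hf : ∀ n, MemLp (f n) 2 P) (K : ℝ)
    (hK : ∀ n : ℕ, ∫ ω, f n ω ^ 2 ∂P ≤ K / (n : ℝ) ^ 2) :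
    ∀ᵐ ω ∂P, Tendsto (fun n => f n ω) atTop (𝓝 0) := by
  have hsum : Summable fun n : ℕ => K / (n : ℝ) ^ 2 := by
    simpa [div_eq_mul_inv] using (Real.summable_nat_pow_inv.2 one_lt_two).mul_left K
  have hint : ∫⁻ ω, ∑' n, ENNReal.ofReal (f n ω ^ 2) ∂P ≠ ⊤ := by
    rw [lintegral_tsum fun n => ((hf n).1.aemeasurable.pow_const 2).ennreal_ofReal]
    have h1 : ∀ n, ∫⁻ ω, ENNReal.ofReal (f n ω ^ 2) ∂P ≤ ENNReal.ofReal (K / (n : ℝ) ^ 2) := by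
      intro n
      rw [← ofReal_integral_eq_lintegral_ofReal (hf n).integrable_sq
        (Eventually.of_forall fun _ => sq_nonneg _)]
      exact ENNReal.ofReal_le_ofReal (hK n)
    exact ne_top_of_le_ne_top hsum.tsum_ofReal_ne_top (ENNReal.tsum_le_tsum h1)
  have hmeas : AEMeasurable (fun ω => ∑' n, ENNReal.ofReal (f n ω ^ 2)) P :=
    AEMeasurable.tsum fun n => ((hf n).1.aemeasurable.pow_const 2).ennreal_ofReal
  filter_upwards [ae_lt_top' hmeas hint] with ω hω
  have h1 := (ENNReal.tendsto_toReal ENNReal.zero_ne_top).comp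
    (ENNReal.tendsto_atTop_zero_of_tsum_ne_top hω.ne)
  have h2 : Tendsto (fun n => f n ω ^ 2) atTop (𝓝 0) := by
    refine h1.congr fun n => ?_
    simp [ENNReal.toReal_ofReal (sq_nonneg _)]
  have h3 := (Real.continuous_sqrt.tendsto 0).comp h2
  rw [Real.sqrt_zero] at h3
  refine tendsto_zero_iff_abs_tendsto_zero _ |>.2 (h3.congr fun n => ?_)
  simp [Real.sqrt_sq_eq_abs]

lemma integral_sum_sq_le {D : ℕ → Ω → ℝ} (hD : ∀ t, MemLp (D t) 2 P) {K : ℝ}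
    (hK : ∀ t, ∫ ω, D t ω ^ 2 ∂P ≤ K) (hort : ∀ s t, s < t → ∫ ω, D s ω * D t ω ∂P = 0) (n : ℕ) :
    ∫ ω, (∑ t ∈ Finset.range n, D t ω) ^ 2 ∂P ≤ n * K := by
  induction n with
  | zero => simp
  | succ n ih =>
    have hS : MemLp (fun ω => ∑ t ∈ Finset.range n, D t ω) 2 P :=
      memLp_finsetSum _ fun t _ => hD t
    have h1 : ∫ ω, (∑ t ∈ Finset.range n, D t ω) * D n ω ∂P = 0 := by
      simp_rw [Finset.sum_mul]
      rw [integral_finsetSum _ fun t _ => show Integrable (fun ω => D t ω * D n ω) P from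
      (hD t).integrable_mul (hD n)]
      exact Finset.sum_eq_zero fun t ht => hort t n (Finset.mem_range.1 ht)
    have h2 : ∀ ω, (∑ t ∈ Finset.range (n + 1), D t ω) ^ 2 =
        (∑ t ∈ Finset.range n, D t ω) ^ 2 + 2 * ((∑ t ∈ Finset.range n, D t ω) * D n ω) +
          D n ω ^ 2 := by
      intro ω
      rw [Finset.sum_range_succ]
      ring
    simp_rw [h2]
    have hi : Integrable (fun ω => 2 * ((∑ t ∈ Finset.range n, D t ω) * D n ω)) P :=
      (hS.integrable_mul (hD n)).const_mul 2
    have hi2 : Integrable (fun ω => (∑ t ∈ Finset.range n, D t ω) ^ 2 +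
        2 * ((∑ t ∈ Finset.range n, D t ω) * D n ω)) P := hS.integrable_sq.add hi
    rw [integral_add hi2 (hD n).integrable_sq, integral_add hS.integrable_sq hi,
      integral_const_mul, h1]
    have := hK n
    push_cast
    linarith

/-- A strong law of large numbers for orthogonal random variables with bounded second moments. -/
theorem ae_meanTendsto_zero {D : ℕ → Ω → ℝ} (hD : ∀ t, MemLp (D t) 2 P) {K : ℝ}
    (hK : ∀ t, ∫ ω, D t ω ^ 2 ∂P ≤ K) (hort : ∀ s t, s < t → ∫ ω, D s ω * D t ω ∂P = 0) :
    ∀ᵐ ω ∂P, MeanTendsto (fun t => D t ω) 0 := by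
  have hK0 : 0 ≤ K := (integral_nonneg fun _ => sq_nonneg _).trans (hK 0)
  -- Along the squares: the average of the first `n ^ 2` terms has second moment at most `K / n ^
  -- 2`.
  have ha := ae_tendsto_zero_of_integral_sq_le
    (f := fun n ω => ((n : ℝ) ^ 2)⁻¹ * ∑ t ∈ Finset.range (n ^ 2), D t ω)
    (fun n => (memLp_finsetSum _ fun t _ => hD t).const_mul _) K (fun n => by
      simp_rw [mul_pow]
      rw [integral_const_mul]
      rcases n.eq_zero_or_pos with rfl | hn
      · simp
      have hn' : (0 : ℝ) < n := by exact_mod_cast hn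
      have := integral_sum_sq_le hD hK hort (n ^ 2)
      push_cast at this
      calc _ ≤ (((n : ℝ) ^ 2)⁻¹) ^ 2 * ((n : ℝ) ^ 2 * K) := by gcongr
        _ = K / (n : ℝ) ^ 2 := by field_simp)
  -- Between consecutive squares there are `2 * n + 1 ≤ 3 * n` terms; Cauchy–Schwarz bounds the
  -- second moment of their absolute sum by `9 * n ^ 2 * K`.
  have hb := ae_tendsto_zero_of_integral_sq_le
    (f := fun n ω => ((n : ℝ) ^ 2)⁻¹ * ∑ t ∈ Finset.Ico (n ^ 2) ((n + 1) ^ 2), |D t ω|)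
    (fun n => (memLp_finsetSum _ fun t _ => (hD t).abs).const_mul _) (9 * K) (fun n => by
      simp_rw [mul_pow]
      rw [integral_const_mul]
      rcases n.eq_zero_or_pos with rfl | hn
      · simp
      have hn' : (0 : ℝ) < n := by exact_mod_cast hn
      have hn1 : (1 : ℝ) ≤ n := by exact_mod_cast hn
      have hcard : (Finset.Ico (n ^ 2) ((n + 1) ^ 2)).card = 2 * n + 1 := by
        rw [Nat.card_Ico]
        have : (n + 1) ^ 2 = n ^ 2 + (2 * n + 1) := by ring
        omega
      have h1 : ∫ ω, (∑ t ∈ Finset.Ico (n ^ 2) ((n + 1) ^ 2), |D t ω|) ^ 2 ∂P ≤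
          (2 * n + 1) * ((2 * n + 1) * K) := by
        calc _ ≤ ∫ ω, (2 * n + 1) * ∑ t ∈ Finset.Ico (n ^ 2) ((n + 1) ^ 2), D t ω ^ 2 ∂P := by
              refine integral_mono (memLp_finsetSum _ fun t _ => (hD t).abs).integrable_sq
                ((integrable_finsetSum _ fun t _ => (hD t).integrable_sq).const_mul _) ?_
              intro ω
              have := sq_sum_le_card_mul_sum_sq
                (s := Finset.Ico (n ^ 2) ((n + 1) ^ 2)) (f := fun t => |D t ω|)
              rw [hcard] at this
              simpa [sq_abs] using this
          _ = (2 * n + 1) * ∑ t ∈ Finset.Ico (n ^ 2) ((n + 1) ^ 2), ∫ ω, D t ω ^ 2 ∂P := by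
              rw [integral_const_mul, integral_finsetSum _ fun t _ => (hD t).integrable_sq]
          _ ≤ (2 * n + 1) * ∑ t ∈ Finset.Ico (n ^ 2) ((n + 1) ^ 2), K := by
              gcongr with t
              exact hK t
          _ = _ := by
              rw [Finset.sum_const, hcard]
              simp
      calc _ ≤ (((n : ℝ) ^ 2)⁻¹) ^ 2 * ((2 * n + 1) * ((2 * n + 1) * K)) := by gcongr
        _ ≤ (((n : ℝ) ^ 2)⁻¹) ^ 2 * ((3 * n) * ((3 * n) * K)) := by gcongr <;> linarith
        _ = 9 * K / (n : ℝ) ^ 2 := by field_simp; ring)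
  filter_upwards [ha, hb] with ω ha hb
  have hsq : Tendsto Nat.sqrt atTop atTop := by
    refine tendsto_atTop.2 fun k => ?_
    filter_upwards [eventually_ge_atTop (k ^ 2)] with m hm
    exact Nat.le_sqrt'.2 hm
  have hlim := (ha.abs.add hb).comp hsq
  rw [abs_zero, add_zero] at hlim
  refine squeeze_zero_norm' ?_ hlim
  filter_upwards [hsq.eventually_gt_atTop 0, eventually_gt_atTop 0] with m hm hm0
  set n := Nat.sqrt m with hn
  have h1 : n ^ 2 ≤ m := Nat.sqrt_le' m
  have h2 : m < (n + 1) ^ 2 := Nat.lt_succ_sqrt' m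
  have hn0 : (0 : ℝ) < (n : ℝ) ^ 2 := by positivity
  have h3 : ((n : ℝ) ^ 2) ≤ m := by exact_mod_cast h1
  simp only [Function.comp_apply, ← hn]
  rw [Real.norm_eq_abs, abs_div, Nat.abs_cast, abs_mul, abs_of_pos (inv_pos.2 hn0), ← mul_add,
    div_eq_inv_mul]
  have h4 : |∑ t ∈ Finset.range m, D t ω| ≤ |∑ t ∈ Finset.range (n ^ 2), D t ω| +
      ∑ t ∈ Finset.Ico (n ^ 2) ((n + 1) ^ 2), |D t ω| := by
    rw [← Finset.sum_range_add_sum_Ico _ h1]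
    refine (abs_add_le _ _).trans (add_le_add_right ((Finset.abs_sum_le_sum_abs _ _).trans ?_) _)
    exact Finset.sum_le_sum_of_subset_of_nonneg (Finset.Ico_subset_Ico_right h2.le)
      fun _ _ _ => abs_nonneg _
  have h5 : ((m : ℝ))⁻¹ ≤ ((n : ℝ) ^ 2)⁻¹ := inv_anti₀ hn0 h3
  gcongr

end Orthogonal

end BerGV

/-! ### Functions of coordinates on a product space -/

namespace BerGV

open Topology

section Coordinates

variable {ι : Type*}

lemma dependsOn_coord {β : Type*} (φ : ℕ → β) (i : ι) : DependsOn (fun e : ι → ℕ => φ (e i)) {i} :=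
  fun _ _ h => congrArg φ (h i rfl)

lemma dependsOn_op {α β γ : Type*} {s : Set ι} {f : (ι → ℕ) → α} {g : (ι → ℕ) → β}
    (op : α → β → γ) (hf : DependsOn f s) (hg : DependsOn g s) :
    DependsOn (fun e => op (f e) (g e)) s :=
  fun _ _ h => congrArg₂ op (hf h) (hg h)

variable {β γ : Type*} [MeasurableSpace β] [MeasurableSpace γ]

/-- The function factors through finitely many coordinates in `ℕ`, that is, through a countable
discrete space. -/
lemma measurable_of_dependsOn {f : (ι → ℕ) → β} {s : Set ι} (hs : s.Finite)
    (hf : DependsOn f s) : Measurable f := by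
  have : Nonempty β := ⟨f 0⟩
  have : Finite s := hs
  obtain ⟨g, rfl⟩ := dependsOn_iff_exists_comp.1 hf
  exact (measurable_of_countable g).comp (measurable_pi_lambda _ fun i => measurable_pi_apply _)

variable (κ : ι → Measure ℕ) [∀ i, IsProbabilityMeasure (κ i)]

/-- Setting the coordinates outside `s` to zero does not change `f`, and that substitution is
measurable for the coordinates in `s`. -/
lemma measurable_iSup_comap_of_dependsOn {f : (ι → ℕ) → β} (hf : Measurable f) {s : Set ι}
    (h : DependsOn f s) :
    Measurable[⨆ i ∈ s, MeasurableSpace.comap (fun e : ι → ℕ => e i) inferInstance] f := by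
  classical
  have h1 : f = f ∘ fun e i => if i ∈ s then e i else 0 := by
    funext e
    exact h fun i hi => by simp [hi]
  rw [h1]
  refine hf.comp ?_
  refine @measurable_pi_lambda _ _ _ (⨆ i ∈ s, MeasurableSpace.comap
    (fun e : ι → ℕ => e i) inferInstance) _ _ fun i => ?_
  by_cases hi : i ∈ s
  · simp only [hi, if_true]
    refine Measurable.mono (comap_measurable (fun e : ι → ℕ => e i)) ?_ le_rfl
    exact le_iSup₂ (f := fun i (_ : i ∈ s) => MeasurableSpace.comap
      (fun e : ι → ℕ => e i) inferInstance) i hi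
  · simp only [hi, if_false]
    exact @measurable_const _ _ _ (_) _

/-- Functions of disjoint sets of coordinates are independent. -/
lemma indepFun_of_dependsOn {f : (ι → ℕ) → β} {g : (ι → ℕ) → γ} (hf : Measurable f)
    (hg : Measurable g) {s t : Set ι} (hst : Disjoint s t) (hfs : DependsOn f s)
    (hgt : DependsOn g t) : IndepFun f g (Measure.infinitePi κ) := by
  have h1 : iIndep (fun i => MeasurableSpace.comap (fun e : ι → ℕ => e i) inferInstance)
      (Measure.infinitePi κ) :=
    iIndepFun_infinitePi (P := κ) (X := fun _ x => x) fun _ => measurable_id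
  have h2 := indep_iSup_of_disjoint (fun i => (measurable_pi_apply i).comap_le) h1 hst
  rw [IndepFun_iff_Indep]
  exact indep_of_indep_of_le_left (indep_of_indep_of_le_right h2
    (measurable_iSup_comap_of_dependsOn hg hgt).comap_le)
    (measurable_iSup_comap_of_dependsOn hf hfs).comap_le

/-- Products of square integrable predictable factors with centred square integrable functions of
fresh coordinates have vanishing averages. -/
theorem ae_meanTendsto_mul_coord {j : ℕ → ι} {c : ℕ → (ι → ℕ) → ℝ} {C : ℕ → Set ι}
    (hfin : ∀ t, (C t).Finite) (hc : ∀ t, DependsOn (c t) (C t)) (hj : ∀ t, j t ∉ C t)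
    (hmono : ∀ s t, s < t → insert (j s) (C s) ⊆ C t) {κ₀ : Measure ℕ} (hκ : ∀ t, κ (j t) = κ₀)
    {φ : ℕ → ℝ} (hφ : MemLp φ 2 κ₀) (hφ0 : ∫ x, φ x ∂κ₀ = 0)
    (hc2 : ∀ t, MemLp (c t) 2 (Measure.infinitePi κ)) {K : ℝ}
    (hK : ∀ t, ∫ e, c t e ^ 2 ∂(Measure.infinitePi κ) ≤ K) :
    ∀ᵐ e ∂(Measure.infinitePi κ), MeanTendsto (fun t => c t e * φ (e (j t))) 0 := by
  have hmp : ∀ t, MeasurePreserving (fun e : ι → ℕ => e (j t)) (Measure.infinitePi κ) κ₀ :=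
    fun t => hκ t ▸ measurePreserving_eval_infinitePi κ (j t)
  have hφm : ∀ t, MemLp (fun e : ι → ℕ => φ (e (j t))) 2 (Measure.infinitePi κ) :=
    fun t => hφ.comp_measurePreserving (hmp t)
  have hint : ∀ (ψ : ℕ → ℝ) t, ∫ e, ψ (e (j t)) ∂(Measure.infinitePi κ) = ∫ x, ψ x ∂κ₀ := by
    intro ψ t
    rw [← (hmp t).map_eq, integral_map (hmp t).measurable.aemeasurable
      (measurable_of_countable ψ).aestronglyMeasurable]
  have hcm : ∀ t, Measurable (c t) := fun t => measurable_of_dependsOn (hfin t) (hc t)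
  have hjm : ∀ (ψ : ℕ → ℝ) t, Measurable fun e : ι → ℕ => ψ (e (j t)) :=
    fun ψ t => (measurable_of_countable ψ).comp (measurable_pi_apply _)
  have hdis : ∀ t, Disjoint (C t) {j t} := fun t => Set.disjoint_singleton_right.2 (hj t)
  have hsq : ∀ t, IndepFun (fun e => c t e ^ 2) (fun e => φ (e (j t)) ^ 2)
      (Measure.infinitePi κ) := fun t =>
    indepFun_of_dependsOn κ ((hcm t).pow_const 2) (hjm (fun x => φ x ^ 2) t) (hdis t)
      (fun _ _ h => by simp only [hc t h]) (dependsOn_coord (fun x => φ x ^ 2) _)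
  refine ae_meanTendsto_zero (K := K * ∫ x, φ x ^ 2 ∂κ₀) ?_ ?_ ?_
  · intro t
    have hae : AEStronglyMeasurable (fun e => c t e * φ (e (j t))) (Measure.infinitePi κ) :=
      ((hcm t).mul (hjm φ t)).aestronglyMeasurable
    rw [memLp_two_iff_integrable_sq hae]
    simp_rw [mul_pow]
    exact (hsq t).integrable_mul (hc2 t).integrable_sq (hφm t).integrable_sq
  · intro t
    simp_rw [mul_pow]
    have := (hsq t).integral_mul_eq_mul_integral
      ((hcm t).pow_const 2).aestronglyMeasurable
      (hjm (fun x => φ x ^ 2) t).aestronglyMeasurable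
    simp only [Pi.mul_apply] at this
    rw [this, hint fun x => φ x ^ 2]
    exact mul_le_mul_of_nonneg_right (hK t) (integral_nonneg fun _ => sq_nonneg _)
  -- Everything in the product except the last factor is known from `C t`, hence independent of the
  -- fresh centred coordinate `j t`.
  · intro s t hst
    have hsub := hmono s t hst
    have hd : DependsOn (fun e => c s e * φ (e (j s)) * c t e) (C t) :=
      dependsOn_op _ (dependsOn_op _ ((hc s).mono ((Set.subset_insert _ _).trans hsub))
        ((dependsOn_coord φ _).mono
          (Set.singleton_subset_iff.2 (hsub (Set.mem_insert _ _))))) (hc t)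
    have hi := indepFun_of_dependsOn κ (((hcm s).mul (hjm φ s)).mul (hcm t)) (hjm φ t) (hdis t) hd
      (dependsOn_coord φ _)
    have := hi.integral_mul_eq_mul_integral
      (((hcm s).mul (hjm φ s)).mul (hcm t)).aestronglyMeasurable
      (hjm φ t).aestronglyMeasurable
    rw [hint φ, hφ0, mul_zero] at this
    rw [← this]
    refine integral_congr_ae (Eventually.of_forall fun e => ?_)
    simp only [Pi.mul_apply]
    ring

end Coordinates

end BerGV

/-! ### The canonical input sequence and weighted laws of large numbers -/

namespace BerGV

open Topology

/-- The indices of the input variables: arrivals, services, vacations. -/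
abbrev Idx := ℕ ⊕ ℕ ⊕ ℕ

/-- The slot to which an input variable belongs. -/
def Idx.slot : Idx → ℕ := Sum.elim id (Sum.elim id id)

/-- The input variables of the slots before `t`. -/
def past (t : ℕ) : Set Idx := {i | i.slot < t}

/-- All coordinates are natural numbers, so that one product space carries the three kinds of input;
an arrival is a nonzero coordinate. -/
def arrivals (e : Idx → ℕ) (t : ℕ) : Bool := e (.inl t) != 0

def services (e : Idx → ℕ) (t : ℕ) : ℕ := e (.inr (.inl t))

def vacations (e : Idx → ℕ) (t : ℕ) : ℕ := e (.inr (.inr t))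

/-- The workload as a function of the input sequence. -/
def work (t : ℕ) (e : Idx → ℕ) : ℕ := workload (arrivals e) (services e) (vacations e) t

/-- The time since the last generation as a function of the input sequence. -/
def since (a₀ t : ℕ) (e : Idx → ℕ) : ℕ := elapsed (arrivals e) a₀ t

lemma past_finite (t : ℕ) : (past t).Finite := by
  refine (((Set.finite_lt_nat t).image Sum.inl).union (((Set.finite_lt_nat t).image
    (Sum.inr ∘ Sum.inl)).union ((Set.finite_lt_nat t).image (Sum.inr ∘ Sum.inr)))).subset ?_
  rintro (i | i | i) hi
  · exact .inl ⟨i, hi, rfl⟩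
  · exact .inr (.inl ⟨i, hi, rfl⟩)
  · exact .inr (.inr ⟨i, hi, rfl⟩)

lemma past_mono {s t : ℕ} (h : s ≤ t) : past s ⊆ past t :=
  fun _ hi => lt_of_lt_of_le (show _ < s from hi) h

lemma mem_past_iff {i : Idx} {t : ℕ} : i ∈ past t ↔ i.slot < t := Iff.rfl

lemma dependsOn_work (t : ℕ) : DependsOn (work t) (past t) := by
  induction t with
  | zero => intro x y _; rfl
  | succ t ih =>
    intro x y h
    have h1 : work t x = work t y := ih.mono (past_mono t.le_succ) h
    have h2 : arrivals x t = arrivals y t := by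
      unfold arrivals; rw [h (.inl t) (Nat.lt_succ_self t)]
    have h3 : services x t = services y t := h (.inr (.inl t)) (Nat.lt_succ_self t)
    have h4 : vacations x t = vacations y t := h (.inr (.inr t)) (Nat.lt_succ_self t)
    unfold work at h1 ⊢
    rw [workload, workload, h1, h2, h3, h4]

lemma dependsOn_since (a₀ t : ℕ) : DependsOn (since a₀ t) (past t) := by
  induction t with
  | zero => intro x y _; rfl
  | succ t ih =>
    intro x y h
    have h1 : since a₀ t x = since a₀ t y := ih.mono (past_mono t.le_succ) h
    have h2 : arrivals x t = arrivals y t := by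
      unfold arrivals; rw [h (.inl t) (Nat.lt_succ_self t)]
    unfold since at h1 ⊢
    rw [elapsed, elapsed, h1, h2]

/-- The laws of the input variables. -/
noncomputable def inputLaw (β σ ν : Measure ℕ) : Idx → Measure ℕ :=
  Sum.elim (fun _ => β) (Sum.elim (fun _ => σ) fun _ => ν)

instance (β σ ν : Measure ℕ) [IsProbabilityMeasure β] [IsProbabilityMeasure σ]
    [IsProbabilityMeasure ν] (i : Idx) : IsProbabilityMeasure (inputLaw β σ ν i) := by
  rcases i with i | i | i <;> simp only [inputLaw, Sum.elim_inl, Sum.elim_inr] <;> infer_instance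

/-- The law of the input sequence. -/
noncomputable abbrev inputMeasure (β σ ν : Measure ℕ) [IsProbabilityMeasure β]
    [IsProbabilityMeasure σ] [IsProbabilityMeasure ν] : Measure (Idx → ℕ) :=
  Measure.infinitePi (inputLaw β σ ν)

section Limits

variable {β σ ν : Measure ℕ} [IsProbabilityMeasure β] [IsProbabilityMeasure σ]
  [IsProbabilityMeasure ν]

lemma integral_coord (ψ : ℕ → ℝ) (i : Idx) :
    ∫ e, ψ (e i) ∂(inputMeasure β σ ν) = ∫ x, ψ x ∂(inputLaw β σ ν i) := by
  have hmp := measurePreserving_eval_infinitePi (inputLaw β σ ν) i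
  conv_rhs => rw [← hmp.map_eq]
  rw [integral_map hmp.measurable.aemeasurable
      (measurable_of_countable ψ).aestronglyMeasurable]

lemma since_le (a₀ t : ℕ) (e : Idx → ℕ) : since a₀ t e ≤ a₀ + t + 1 := by
  induction t with
  | zero => exact Nat.le_succ _
  | succ t ih =>
    unfold since at ih ⊢
    rw [elapsed]
    split_ifs <;> omega

lemma measurable_since (a₀ t : ℕ) : Measurable (since a₀ t) :=
  measurable_of_dependsOn (past_finite t) (dependsOn_since a₀ t)

lemma memLp_since (a₀ t : ℕ) :
    MemLp (fun e => (since a₀ t e : ℝ)) 2 (inputMeasure β σ ν) := by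
  refine MemLp.of_bound ((measurable_of_countable _).comp
    (measurable_since a₀ t)).aestronglyMeasurable (a₀ + t + 1 : ℕ)
    (Eventually.of_forall fun e => ?_)
  rw [Real.norm_natCast]
  exact Nat.cast_le.2 (since_le a₀ t e)

/-- The probability of an arrival. -/
noncomputable def rate (β : Measure ℕ) : ℝ := ∫ n, (if n ≠ 0 then 1 else 0 : ℝ) ∂β

lemma integrable_ite_ne_zero (a b : ℝ) : Integrable (fun n : ℕ => if n ≠ 0 then a else b) β := by
  refine Integrable.of_bound (measurable_of_countable _).aestronglyMeasurable (max |a| |b|)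
    (Eventually.of_forall fun n => ?_)
  split_ifs
  · exact le_max_left _ _
  · exact le_max_right _ _

lemma integral_not_arrival : ∫ n, (if n ≠ 0 then 0 else 1 : ℝ) ∂β = 1 - rate β := by
  have h : ∀ n : ℕ, (if n ≠ 0 then 0 else 1 : ℝ) = 1 - if n ≠ 0 then 1 else 0 := by
    intro n; split_ifs <;> norm_num
  simp_rw [h]
  rw [integral_sub (integrable_const _) (integrable_ite_ne_zero _ _)]
  simp [rate]

/-- The elapsed time `X` survives a slot with probability `1 - l`, and `(X + 1) ^ 2 ≤ (1 + l) * X ^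
2 + 1 + 1 / l`, so the second moment contracts by `1 - l ^ 2` up to a constant. The bound is
preserved by this recursion, and `a₀ ^ 2` covers the start. -/
lemma exists_integral_since_sq_le (a₀ : ℕ) (h0 : 0 < rate β) (h1 : rate β ≤ 1) :
    ∃ K, ∀ t, ∫ e, (since a₀ t e : ℝ) ^ 2 ∂(inputMeasure β σ ν) ≤ K := by
  set l := rate β with hl
  refine ⟨(a₀ : ℝ) ^ 2 + (2 + 1 / l) / l ^ 2, fun t => ?_⟩
  induction t with
  | zero =>
    simp only [since, elapsed, integral_const, probReal_univ, one_smul]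
    have : 0 ≤ (2 + 1 / l) / l ^ 2 := by positivity
    linarith
  | succ t ih =>
    have hX := (memLp_since (β := β) (σ := σ) (ν := ν) a₀ t).integrable_sq
    have hpt : ∀ e, (since a₀ (t + 1) e : ℝ) ^ 2 ≤ 1 +
        ((1 + l) * (since a₀ t e : ℝ) ^ 2 + (1 + 1 / l)) *
          (if e (.inl t) ≠ 0 then 0 else 1 : ℝ) := by
      intro e
      unfold since
      rw [elapsed]
      by_cases h : e (.inl t) = 0
      · have ha : arrivals e t = false := by simp [arrivals, h]
        simp only [ha, h, ne_eq, not_true_eq_false, if_false, mul_one]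
        push_cast
        -- This square yields `2 * X ≤ l * X ^ 2 + 1 / l`.
        have : 0 ≤ (l * (elapsed (arrivals e) a₀ t : ℝ) - 1) ^ 2 / l := by positivity
        have h2 : (l * (elapsed (arrivals e) a₀ t : ℝ) - 1) ^ 2 / l =
          l * (elapsed (arrivals e) a₀ t : ℝ) ^ 2 - 2 * (elapsed (arrivals e) a₀ t : ℝ) + 1 / l := by
          field_simp
          ring
        nlinarith
      · have ha : arrivals e t = true := by simp [arrivals, h]
        simp [ha, h]
    have hind : IndepFun (fun e : Idx → ℕ => (1 + l) * (since a₀ t e : ℝ) ^ 2 + (1 + 1 / l))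
        (fun e => (if e (.inl t) ≠ 0 then 0 else 1 : ℝ)) (inputMeasure β σ ν) := by
      refine indepFun_of_dependsOn _ ((measurable_of_countable fun n : ℕ =>
        (1 + l) * (n : ℝ) ^ 2 + (1 + 1 / l)).comp (measurable_since a₀ t))
        ((measurable_of_countable fun n : ℕ => (if n ≠ 0 then 0 else 1 : ℝ)).comp
          (measurable_pi_apply _)) (s := past t) (t := {.inl t}) ?_ ?_
        (dependsOn_coord (fun n => (if n ≠ 0 then 0 else 1 : ℝ)) _)
      · exact Set.disjoint_singleton_right.2 fun h => lt_irrefl t h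
      · intro x y h
        beta_reduce
        rw [dependsOn_since a₀ t h]
    have hi1 : Integrable (fun e : Idx → ℕ => (1 + l) * (since a₀ t e : ℝ) ^ 2 + (1 + 1 / l))
      (inputMeasure β σ ν) := (hX.const_mul _).add (integrable_const _)
    have hi2 : Integrable (fun e : Idx → ℕ => (if e (.inl t) ≠ 0 then 0 else 1 : ℝ))
      (inputMeasure β σ ν) :=
      (measurePreserving_eval_infinitePi (inputLaw β σ ν) (.inl t)).integrable_comp_of_integrable
        (integrable_ite_ne_zero (β := β) 0 1)
    have hprod := hind.integral_mul_eq_mul_integral hi1.1 hi2.1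
    have hval : ∫ e : Idx → ℕ, (if e (.inl t) ≠ 0 then 0 else 1 : ℝ) ∂(inputMeasure β σ ν) =
        1 - l := by
      rw [integral_coord (fun n => (if n ≠ 0 then 0 else 1 : ℝ))]
      exact integral_not_arrival
    have hi3 : Integrable (fun e : Idx → ℕ => ((1 + l) * (since a₀ t e : ℝ) ^ 2 + (1 + 1 / l)) *
      (if e (.inl t) ≠ 0 then 0 else 1 : ℝ)) (inputMeasure β σ ν) := hind.integrable_mul hi1 hi2
    calc _ ≤ ∫ e, (1 + ((1 + l) * (since a₀ t e : ℝ) ^ 2 + (1 + 1 / l)) *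
          (if e (.inl t) ≠ 0 then 0 else 1 : ℝ)) ∂(inputMeasure β σ ν) :=
          integral_mono (memLp_since a₀ (t + 1)).integrable_sq
            ((integrable_const 1).add hi3) hpt
      _ = 1 + ((1 + l) * ∫ e, (since a₀ t e : ℝ) ^ 2 ∂(inputMeasure β σ ν) + (1 + 1 / l)) *
          (1 - l) := by
        rw [integral_add (integrable_const 1) hi3]
        simp only [Pi.mul_apply] at hprod
        rw [hprod, hval, integral_add (hX.const_mul _) (integrable_const _), integral_const_mul]
        simp
      _ ≤ 1 + ((1 + l) * ((a₀ : ℝ) ^ 2 + (2 + 1 / l) / l ^ 2) + (1 + 1 / l)) * (1 - l) := by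
        gcongr
      _ = (a₀ : ℝ) ^ 2 + (2 + 1 / l) / l ^ 2 - l ^ 2 * (a₀ : ℝ) ^ 2 - 1 - l := by
        field_simp
        ring
      _ ≤ _ := by nlinarith [sq_nonneg (l * (a₀ : ℝ))]

lemma ae_tendsto_since_div (a₀ : ℕ) (h0 : 0 < rate β) (h1 : rate β ≤ 1) :
    ∀ᵐ e ∂(inputMeasure β σ ν),
      Tendsto (fun n : ℕ => (since a₀ n e : ℝ) / n) atTop (𝓝 0) := by
  obtain ⟨K, hK⟩ := exists_integral_since_sq_le (σ := σ) (ν := ν) a₀ h0 h1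
  refine ae_tendsto_zero_of_integral_sq_le (f := fun n e => (since a₀ n e : ℝ) / n) (K := K)
    (fun n => ?_) fun n => ?_
  · simp_rw [div_eq_mul_inv]
    exact (memLp_since a₀ n).mul_const _
  · simp_rw [div_pow]
    rw [integral_div]
    exact div_le_div_of_nonneg_right (hK n) (sq_nonneg _)

/-- The law of large numbers for fresh coordinates with weights bounded by the time since the last
generation. -/
lemma ae_meanTendsto_weight (a₀ : ℕ) (h0 : 0 < rate β) (h1 : rate β ≤ 1) {j : ℕ → Idx}
    {c : ℕ → (Idx → ℕ) → ℝ} {C : ℕ → Set Idx} (hfin : ∀ t, (C t).Finite)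
    (hc : ∀ t, DependsOn (c t) (C t)) (hj : ∀ t, j t ∉ C t)
    (hmono : ∀ s t, s < t → insert (j s) (C s) ⊆ C t) {κ₀ : Measure ℕ}
    (hκ : ∀ t, inputLaw β σ ν (j t) = κ₀) {φ : ℕ → ℝ} (hφ : MemLp φ 2 κ₀)
    (hφ0 : ∫ x, φ x ∂κ₀ = 0) (hbound : ∀ t e, |c t e| ≤ since a₀ t e + 1) :
    ∀ᵐ e ∂(inputMeasure β σ ν), MeanTendsto (fun t => c t e * φ (e (j t))) 0 := by
  obtain ⟨K, hK⟩ := exists_integral_since_sq_le (σ := σ) (ν := ν) a₀ h0 h1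
  have hmem : ∀ t, MemLp (c t) 2 (inputMeasure β σ ν) := fun t => by
    refine MemLp.mono ((memLp_since a₀ t).add (memLp_const 1))
      (measurable_of_dependsOn (hfin t) (hc t)).aestronglyMeasurable
      (Eventually.of_forall fun e => ?_)
    refine (hbound t e).trans (le_of_eq ?_)
    simp only [Pi.add_apply, Real.norm_eq_abs]
    rw [abs_of_nonneg (by positivity)]
  refine ae_meanTendsto_mul_coord _ hfin hc hj hmono hκ hφ hφ0 hmem (K := 2 * K + 2) fun t => ?_
  calc _ ≤ ∫ e, (2 * (since a₀ t e : ℝ) ^ 2 + 2) ∂(inputMeasure β σ ν) := by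
        refine integral_mono (hmem t).integrable_sq
          (((memLp_since a₀ t).integrable_sq.const_mul 2).add (integrable_const 2)) fun e => ?_
        have := sq_le_sq' (abs_le.1 (hbound t e)).1 (abs_le.1 (hbound t e)).2
        nlinarith [sq_nonneg ((since a₀ t e : ℝ) - 1)]
    _ ≤ _ := by
        rw [integral_add ((memLp_since a₀ t).integrable_sq.const_mul 2) (integrable_const 2),
          integral_const_mul]
        have := hK t
        simp
        linarith

/-- Within a slot the inputs are revealed in the order vacation, arrival, service. The weight of
each may use those before it; in the two lemmas below this lets `afterSlot` and the arrival enter.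
-/
lemma ae_meanTendsto_vacations (a₀ : ℕ) (h0 : 0 < rate β) (h1 : rate β ≤ 1) {φ : ℕ → ℝ}
    (hφ : MemLp φ 2 ν) (hφ0 : ∫ x, φ x ∂ν = 0) {F : ℕ → ℕ → ℝ} (hF : ∀ w x, |F w x| ≤ x + 1) :
    ∀ᵐ e ∂(inputMeasure β σ ν),
      MeanTendsto (fun t => F (work t e) (since a₀ t e) * φ (vacations e t)) 0 := by
  refine ae_meanTendsto_weight a₀ h0 h1 (j := fun t => .inr (.inr t)) (C := past) past_finite
    (fun t => dependsOn_op F (dependsOn_work t) (dependsOn_since a₀ t)) ?_ ?_ (fun _ => rfl) hφ hφ0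
    fun t e => hF _ _
  · exact fun t h => lt_irrefl t h
  · exact fun s t h => Set.insert_subset h (past_mono h.le)

lemma ae_meanTendsto_arrivals (a₀ : ℕ) (h0 : 0 < rate β) (h1 : rate β ≤ 1) {φ : ℕ → ℝ}
    (hφ : MemLp φ 2 β) (hφ0 : ∫ x, φ x ∂β = 0) {F : ℕ → ℕ → ℕ → ℝ}
    (hF : ∀ w x v, |F w x v| ≤ x + 1) :
    ∀ᵐ e ∂(inputMeasure β σ ν), MeanTendsto
      (fun t => F (work t e) (since a₀ t e) (vacations e t) * φ (e (.inl t))) 0 := by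
  refine ae_meanTendsto_weight a₀ h0 h1 (j := fun t => .inl t)
    (C := fun t => insert (.inr (.inr t)) (past t)) (fun t => (past_finite t).insert _)
    (fun t x y h => ?_) ?_ ?_ (fun _ => rfl) hφ hφ0 fun t e => hF _ _ _
  · have hp : ∀ i ∈ past t, x i = y i := fun i hi => h i (Set.mem_insert_of_mem _ hi)
    have hv : vacations x t = vacations y t := h _ (Set.mem_insert _ _)
    simp only [dependsOn_work t hp, dependsOn_since a₀ t hp, hv]
  · rintro t (h | h)
    · cases h
    · exact lt_irrefl t h
  · intro s t h
    refine (Set.insert_subset ?_ (Set.insert_subset ?_ (past_mono h.le))).trans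
      (Set.subset_insert _ _)
    · exact h
    · exact h

lemma ae_meanTendsto_services (a₀ : ℕ) (h0 : 0 < rate β) (h1 : rate β ≤ 1) {φ : ℕ → ℝ}
    (hφ : MemLp φ 2 σ) (hφ0 : ∫ x, φ x ∂σ = 0) {F : ℕ → ℕ → ℕ → Bool → ℝ}
    (hF : ∀ w x v b, |F w x v b| ≤ x + 1) :
    ∀ᵐ e ∂(inputMeasure β σ ν), MeanTendsto
      (fun t => F (work t e) (since a₀ t e) (vacations e t) (arrivals e t) *
        φ (services e t)) 0 := by
  refine ae_meanTendsto_weight a₀ h0 h1 (j := fun t => .inr (.inl t))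
    (C := fun t => insert (.inl t) (insert (.inr (.inr t)) (past t)))
    (fun t => ((past_finite t).insert _).insert _)
    (fun t x y h => ?_) ?_ ?_ (fun _ => rfl) hφ hφ0 fun t e => hF _ _ _ _
  · have hp : ∀ i ∈ past t, x i = y i := fun i hi =>
      h i (Set.mem_insert_of_mem _ (Set.mem_insert_of_mem _ hi))
    have hv : vacations x t = vacations y t := h _ (Set.mem_insert_of_mem _ (Set.mem_insert _ _))
    have hb : arrivals x t = arrivals y t := by
      unfold arrivals
      rw [h _ (Set.mem_insert _ _)]
    simp only [dependsOn_work t hp, dependsOn_since a₀ t hp, hv, hb]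
  · rintro t (h | h | h)
    · cases h
    · cases h
    · exact lt_irrefl t h
  · intro s t h
    refine (Set.insert_subset ?_ (Set.insert_subset ?_ (Set.insert_subset ?_
      (past_mono h.le)))).trans ((Set.subset_insert _ _).trans (Set.subset_insert _ _))
    · exact h
    · exact h
    · exact h

end Limits

end BerGV

/-! ### Elapsed times at the starts of vacations -/

namespace BerGV

open Topology

section Idle

variable {B : ℕ → Bool} {S V : ℕ → ℕ}

lemma MeanTendsto.congr' {f g : ℕ → ℝ} {a b : ℝ} (hf : MeanTendsto f a) (h : ∀ t, f t = g t)
    (hab : a = b) : MeanTendsto g b := hab ▸ hf.congr h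

/-- The time since the last generation at the starts of vacations, weighted with the lengths of the
vacations: its averages follow from the drifts of `W`, `q ^ W` and `X * q ^ W`, where `W` is the
workload and `X` the time since the last generation. -/
theorem meanTendsto_elapsed_mul_vacation (hV : ∀ t, 1 ≤ V t) (a₀ : ℕ) {q lam sg w v r z : ℝ}
    (hq : 0 < q) (hq1 : q = 1 - lam) (hlam : 0 < lam) (hsg : 0 < sg) (hw : w < 1) (hv : 0 < v)
    (hW : MeanTendsto (fun t => (workload B S V t : ℝ)) z)
    (hX : Tendsto (fun n : ℕ => (elapsed B a₀ n : ℝ) / n) atTop (𝓝 0))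
    (hBS : MeanTendsto (fun t => if B t then (S t : ℝ) else 0) r)
    (hI : MeanTendsto (fun t => (if workload B S V t = 0 then 1 else 0) * ((V t : ℝ) - v)) 0)
    (hXI : MeanTendsto (fun t => (if workload B S V t = 0 then (elapsed B a₀ t : ℝ) else 0) *
      ((V t : ℝ) - v)) 0)
    (hIw : MeanTendsto (fun t => (if workload B S V t = 0 then 1 else 0) * (q ^ V t - w)) 0)
    (hXIw : MeanTendsto (fun t => (if workload B S V t = 0 then (elapsed B a₀ t : ℝ) else 0) *
      (q ^ V t - w)) 0)
    (hRB : MeanTendsto (fun t => q ^ afterSlot (workload B S V t) (V t) *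
      ((if B t then 1 else 0) - lam)) 0)
    (hXRB : MeanTendsto (fun t => (elapsed B a₀ t * q ^ afterSlot (workload B S V t) (V t)) *
      ((if B t then 1 else 0) - lam)) 0)
    (hRBS : MeanTendsto (fun t => (if B t then q ^ afterSlot (workload B S V t) (V t) else 0) *
      (q ^ S t - sg)) 0) :
    MeanTendsto (fun t => (elapsed B a₀ t : ℝ) * if workload B S V t = 0 then (V t : ℝ) else 0)
      ((1 - r) * (q + lam * sg) / (lam * sg)) := by
  have hqle : q ≤ 1 := by linarith
  have hafter : ∀ t, (afterSlot (workload B S V t) (V t) : ℝ) + 1 =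
      workload B S V t + if workload B S V t = 0 then (V t : ℝ) else 0 := by
    intro t
    have := workload_succ_add_one (B := B) (S := S) hV t
    exact_mod_cast this
  have hqR : ∀ t, q * q ^ afterSlot (workload B S V t) (V t) =
      q ^ workload B S V t - if workload B S V t = 0 then 1 - q ^ V t else 0 := by
    intro t
    have := workload_succ_add_one (B := B) (S := S) hV t
    rw [← pow_succ', this]
    split_ifs with h <;> simp [h]
  have hU : ∀ t, q ^ workload B S V (t + 1) = q ^ afterSlot (workload B S V t) (V t) *
      if B t then q ^ S t else 1 := by
    intro t
    rw [workload]
    split_ifs <;> simp [pow_add]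
  -- Zero mean drift of the workload: vacation time fills the fraction of time not spent on service.
  have hIV : MeanTendsto (fun t => if workload B S V t = 0 then (V t : ℝ) else 0) (1 - r) := by
    refine (((MeanTendsto.of_potential hW.tendsto_div).add (MeanTendsto.const 1)).sub hBS).congr'
      (fun t => ?_) (by ring)
    rw [workload]
    push_cast
    linear_combination hafter t
  have hI1 : MeanTendsto (fun t => if workload B S V t = 0 then (1 : ℝ) else 0)
      ((1 - r) / v) := by
    refine ((hIV.sub hI).const_mul v⁻¹).congr' (fun t => ?_) (by field_simp; ring)
    split_ifs <;> field_simp <;> ring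
  have hUdiv : Tendsto (fun n : ℕ => q ^ workload B S V n / (n : ℝ)) atTop (𝓝 0) := by
    refine squeeze_zero (fun n => by positivity) (fun n => ?_)
      (tendsto_const_div_atTop_nhds_zero_nat 1)
    exact div_le_div_of_nonneg_right (pow_le_one₀ hq.le hqle) (Nat.cast_nonneg n)
  -- Zero mean drift of `q ^ W`. An arrival multiplies by `sg` on average and the unit of work done
  -- divides by `q`; as `q + lam * sg - q = lam * sg`, the average of `q ^ afterSlot` is expressed
  -- by the frequency of vacations.
  have hR : MeanTendsto (fun t => q ^ afterSlot (workload B S V t) (V t))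
      ((1 - w) * ((1 - r) / v) / (lam * sg)) := by
    refine (((((((MeanTendsto.of_potential hUdiv).add (hI1.const_mul (1 - w))).sub hIw).sub
      hRBS).add (hRB.const_mul (1 - sg)))).const_mul (lam * sg)⁻¹).congr' (fun t => ?_)
      (by ring)
    rw [inv_mul_eq_div, div_eq_iff (by positivity), hU]
    have h := hqR t
    rw [hq1] at h ⊢
    rw [hq1] at hqR
    split_ifs at h ⊢ <;> linear_combination h
  have hUavg : MeanTendsto (fun t => q ^ workload B S V (t + 1))
      ((1 - w) * ((1 - r) / v) / (lam * sg) * (q + lam * sg)) := by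
    refine ((hR.const_mul (q + lam * sg)).add (hRBS.sub (hRB.const_mul (1 - sg)))).congr'
      (fun t => ?_) (by ring)
    rw [hU, hq1]
    split_ifs <;> ring
  have hXUdiv : Tendsto (fun n : ℕ => (elapsed B a₀ n * q ^ workload B S V n) / (n : ℝ))
      atTop (𝓝 0) := by
    refine squeeze_zero (fun n => by positivity) (fun n => ?_) hX
    refine div_le_div_of_nonneg_right ?_ (Nat.cast_nonneg n)
    exact mul_le_of_le_one_right (Nat.cast_nonneg _) (pow_le_one₀ hq.le hqle)
  -- Zero mean drift of `X * q ^ W`. Without an arrival, of probability `1 - lam = q`, the elapsed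
  -- time persists, and this `q` cancels the division by `q` from the work done. Thus the unknown
  -- average of `X * q ^ W` drops out, leaving that of `X` at the starts of vacations; this dictates
  -- the choice of `q`.
  have hXI1 : MeanTendsto (fun t => if workload B S V t = 0 then (elapsed B a₀ t : ℝ) else 0)
      ((1 - r) / v / (lam * sg) * (q + lam * sg)) := by
    have hw' : 1 - w ≠ 0 := by linarith
    refine ((((hUavg.add hXIw).sub hXRB).sub (MeanTendsto.of_potential hXUdiv)).const_mul
      (1 - w)⁻¹).congr' (fun t => ?_) (by field_simp; ring)
    rw [inv_mul_eq_div, div_eq_iff hw', hU, elapsed]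
    have h := hqR t
    rw [hq1] at h ⊢
    split_ifs at h ⊢ <;> push_cast <;> linear_combination -(elapsed B a₀ t : ℝ) * h
  refine ((hXI1.const_mul v).add hXI).congr' (fun t => ?_) (by field_simp; ring)
  split_ifs <;> ring

end Idle

section Almost

variable {β σ ν : Measure ℕ} [IsProbabilityMeasure β] [IsProbabilityMeasure σ]
  [IsProbabilityMeasure ν]

lemma memLp_pow_sub {σ : Measure ℕ} [IsProbabilityMeasure σ] {q : ℝ} (hq : 0 ≤ q) (hq1 : q ≤ 1)
    (c : ℝ) : MemLp (fun n : ℕ => q ^ n - c) 2 σ := by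
  refine MemLp.sub (MemLp.of_bound (measurable_of_countable _).aestronglyMeasurable 1
    (Eventually.of_forall fun n => ?_)) (memLp_const c)
  rw [Real.norm_of_nonneg (by positivity)]
  exact pow_le_one₀ hq hq1

lemma integral_sub_self {σ : Measure ℕ} [IsProbabilityMeasure σ] {f : ℕ → ℝ}
    (hf : Integrable f σ) : ∫ n, (f n - ∫ m, f m ∂σ) ∂σ = 0 := by
  rw [integral_sub hf (integrable_const _)]
  simp

lemma memLp_natCast {σ : Measure ℕ} (h : Integrable (fun n : ℕ => (n : ℝ) ^ 2) σ) :
    MemLp (fun n : ℕ => (n : ℝ)) 2 σ :=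
  (memLp_two_iff_integrable_sq (measurable_of_countable _).aestronglyMeasurable).2 h

lemma integrable_pow {σ : Measure ℕ} [IsProbabilityMeasure σ] {q : ℝ} (hq : 0 ≤ q)
    (hq1 : q ≤ 1) : Integrable (fun n : ℕ => q ^ n) σ := by
  simpa using (memLp_pow_sub (σ := σ) hq hq1 0).integrable one_le_two

/-- Bernoulli's inequality, integrated. -/
lemma one_sub_le_integral_pow {σ : Measure ℕ} [IsProbabilityMeasure σ] {l : ℝ}
    (hq0 : 0 ≤ l) (h1 : l ≤ 1)
    (hσ : Integrable (fun n : ℕ => (n : ℝ)) σ) :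
    1 - l * ∫ n, (n : ℝ) ∂σ ≤ ∫ n, (1 - l) ^ n ∂σ := by
  calc _ = ∫ n : ℕ, (1 - l * (n : ℝ)) ∂σ := by
        rw [integral_sub (integrable_const _) (hσ.const_mul _), integral_const_mul]
        simp
    _ ≤ _ := by
        refine integral_mono ((integrable_const _).sub (hσ.const_mul _))
          (integrable_pow (by linarith) (by linarith)) fun n => ?_
        have := one_add_mul_le_pow (show (-2 : ℝ) ≤ -l by linarith) n
        simp only [← sub_eq_add_neg] at this
        linarith

lemma memLp_arrival_sub (c : ℝ) : MemLp (fun n : ℕ => (if n ≠ 0 then 1 else 0 : ℝ) - c) 2 β := by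
  refine MemLp.sub (MemLp.of_bound (measurable_of_countable _).aestronglyMeasurable 1
    (Eventually.of_forall fun n => ?_)) (memLp_const c)
  split_ifs <;> simp

lemma ae_coord {p : ℕ → Prop} (i : Idx) (h : ∀ᵐ n ∂(inputLaw β σ ν i), p n) :
    ∀ᵐ e ∂(inputMeasure β σ ν), p (e i) :=
  (measurePreserving_eval_infinitePi (inputLaw β σ ν) i).quasiMeasurePreserving.ae h

lemma ae_one_le_services (h : ∀ᵐ n ∂σ, 1 ≤ n) :
    ∀ᵐ e ∂(inputMeasure β σ ν), ∀ t, 1 ≤ services e t :=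
  ae_all_iff.2 fun t => ae_coord (.inr (.inl t)) h

lemma ae_one_le_vacations (h : ∀ᵐ n ∂ν, 1 ≤ n) :
    ∀ᵐ e ∂(inputMeasure β σ ν), ∀ t, 1 ≤ vacations e t :=
  ae_all_iff.2 fun t => ae_coord (.inr (.inr t)) h

lemma arrivals_eq_true_iff {e : Idx → ℕ} {t : ℕ} : arrivals e t = true ↔ e (.inl t) ≠ 0 := by
  simp [arrivals]

lemma ae_meanTendsto_arrival (h0 : 0 < rate β) (h1 : rate β ≤ 1) :
    ∀ᵐ e ∂(inputMeasure β σ ν), MeanTendsto (fun t => if arrivals e t then 1 else 0) (rate β) := by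
  filter_upwards [ae_meanTendsto_arrivals (σ := σ) (ν := ν) 0 h0 h1 (memLp_arrival_sub (rate β))
    (integral_sub_self (integrable_ite_ne_zero 1 0)) (F := fun _ _ _ => 1) (by simp)] with e he
  refine (he.add (MeanTendsto.const (rate β))).congr' (fun t => ?_) (by ring)
  simp only [arrivals_eq_true_iff]
  ring

lemma ae_meanTendsto_arrival_service (h0 : 0 < rate β) (h1 : rate β ≤ 1)
    (hσ : Integrable (fun n : ℕ => (n : ℝ) ^ 2) σ) :
    ∀ᵐ e ∂(inputMeasure β σ ν), MeanTendsto
      (fun t => if arrivals e t then (services e t : ℝ) else 0) (rate β * ∫ n, (n : ℝ) ∂σ) := by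
  have hL := memLp_natCast hσ
  filter_upwards [ae_meanTendsto_arrival (σ := σ) (ν := ν) h0 h1,
    ae_meanTendsto_services (β := β) (ν := ν) 0 h0 h1 (hL.sub (memLp_const (∫ n, (n : ℝ) ∂σ)))
      (integral_sub_self (hL.integrable one_le_two))
      (F := fun _ _ _ b => if b then 1 else 0) (fun _ _ _ b => by
        split_ifs <;> simp
        positivity)] with e h2 h3
  refine (h3.add (h2.const_mul (∫ n, (n : ℝ) ∂σ))).congr' (fun t => ?_) (by ring)
  simp only [Pi.sub_apply]
  split_ifs <;> ring

/-- The service time is independent of the gap, and the gaps summed over arrivals average to one per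
slot. -/
lemma ae_meanTendsto_since_service (a₀ : ℕ) (h0 : 0 < rate β) (h1 : rate β ≤ 1)
    (hσ : Integrable (fun n : ℕ => (n : ℝ) ^ 2) σ) :
    ∀ᵐ e ∂(inputMeasure β σ ν), MeanTendsto (fun t => if arrivals e t then
      (elapsed (arrivals e) a₀ t : ℝ) * services e t else 0) (∫ n, (n : ℝ) ∂σ) := by
  have hL := memLp_natCast hσ
  filter_upwards [ae_tendsto_since_div (σ := σ) (ν := ν) a₀ h0 h1,
    ae_meanTendsto_services (β := β) (ν := ν) a₀ h0 h1 (hL.sub (memLp_const (∫ n, (n : ℝ) ∂σ)))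
      (integral_sub_self (hL.integrable one_le_two))
      (F := fun _ x _ b => if b then x else 0) (fun _ _ _ b => by
        split_ifs <;> simp
        positivity)] with e h2 h3
  have h4 := (MeanTendsto.const 1).sub (MeanTendsto.of_potential h2)
  refine (h3.add (h4.const_mul (∫ n, (n : ℝ) ∂σ))).congr' (fun t => ?_) (by ring)
  simp only [Pi.sub_apply, since]
  rw [elapsed]
  split_ifs <;> push_cast <;> ring

lemma integral_pow_lt_one {q : ℝ} (hq : 0 ≤ q) (hq1 : q < 1) (h : ∀ᵐ n ∂ν, 1 ≤ n) :
    ∫ n, q ^ n ∂ν < 1 := by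
  refine lt_of_le_of_lt ?_ hq1
  calc ∫ n, q ^ n ∂ν ≤ ∫ _, q ∂ν := by
        refine integral_mono_ae (integrable_pow hq hq1.le) (integrable_const _) ?_
        filter_upwards [h] with n hn
        exact pow_le_of_le_one hq hq1.le (by omega)
    _ = q := by simp

theorem ae_meanTendsto_since_vacation (a₀ : ℕ) (h0 : 0 < rate β) (h1 : rate β < 1)
    (hσ : Integrable (fun n : ℕ => (n : ℝ) ^ 2) σ) (hν : Integrable (fun n : ℕ => (n : ℝ) ^ 2) ν)
    (hν1 : ∀ᵐ n ∂ν, 1 ≤ n) (hρ : rate β * ∫ n, (n : ℝ) ∂σ < 1) {z : ℝ}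
    (hW : ∀ᵐ e ∂(inputMeasure β σ ν), MeanTendsto (fun t => (work t e : ℝ)) z) :
    ∃ c ≤ 1 / rate β - rate β * ∫ n, (n : ℝ) ∂σ, ∀ᵐ e ∂(inputMeasure β σ ν),
      MeanTendsto (fun t => (elapsed (arrivals e) a₀ t : ℝ) *
        if workload (arrivals e) (services e) (vacations e) t = 0
          then (vacations e t : ℝ) else 0) c := by
  set l := rate β with hl
  set r := l * ∫ n, (n : ℝ) ∂σ with hr
  set sg := ∫ n, (1 - l) ^ n ∂σ with hsg
  have hLσ := memLp_natCast hσ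
  have hLν := memLp_natCast hν
  have hq : 0 < 1 - l := by linarith
  have hq1 : 1 - l ≤ 1 := by linarith
  have hs1 : 1 - r ≤ sg := one_sub_le_integral_pow h0.le h1.le (hLσ.integrable one_le_two)
  have hsg0 : 0 < sg := by linarith
  have hv : 0 < ∫ n, (n : ℝ) ∂ν := by
    have : ∫ _, (1 : ℝ) ∂ν ≤ ∫ n, (n : ℝ) ∂ν := by
      refine integral_mono_ae (integrable_const _) (hLν.integrable one_le_two) ?_
      filter_upwards [hν1] with n hn
      exact_mod_cast hn
    simp at this
    linarith
  refine ⟨(1 - r) * (1 - l + l * sg) / (l * sg), ?_, ?_⟩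
  -- After clearing denominators the claim is `(1 - l) * (1 - r) ≤ (1 - l) * sg`, which is `hs1`.
  · rw [div_le_iff₀ (by positivity)]
    have : (1 / l - r) * (l * sg) = sg - r * l * sg := by field_simp
    rw [this]
    nlinarith
  have bound1 : ∀ w x : ℕ, |if w = 0 then 1 else 0| ≤ (x : ℝ) + 1 := fun w x => by
    split_ifs <;> simp
    positivity
  have bound2 : ∀ w x : ℕ, |if w = 0 then (x : ℝ) else 0| ≤ (x : ℝ) + 1 := fun w x => by
    split_ifs <;> simp
    positivity
  have hpow : ∀ n : ℕ, |(1 - l) ^ n| ≤ 1 := fun n => by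
    rw [abs_of_pos (by positivity)]
    exact pow_le_one₀ hq.le hq1
  have bound3 : ∀ w x v : ℕ, |(1 - l) ^ afterSlot w v| ≤ (x : ℝ) + 1 := fun w x v =>
    (hpow _).trans (le_add_of_nonneg_left (Nat.cast_nonneg x))
  have bound4 : ∀ w x v : ℕ, |(x : ℝ) * (1 - l) ^ afterSlot w v| ≤ (x : ℝ) + 1 := fun w x v => by
    rw [abs_mul, Nat.abs_cast]
    have := mul_le_of_le_one_right (Nat.cast_nonneg (α := ℝ) x) (hpow (afterSlot w v))
    linarith
  have bound5 : ∀ (w x v : ℕ) (b : Bool),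
      |if b = true then (1 - l) ^ afterSlot w v else 0| ≤ (x : ℝ) + 1 := fun w x v b => by
    split_ifs
    · exact bound3 w x v
    · simp; positivity
  have hV := hLν.sub (memLp_const (∫ n, (n : ℝ) ∂ν))
  have hV0 := integral_sub_self (hLν.integrable one_le_two)
  have hw := memLp_pow_sub (σ := ν) hq.le hq1 (∫ n, (1 - l) ^ n ∂ν)
  have hw0 := integral_sub_self (integrable_pow (σ := ν) hq.le hq1)
  have hb := memLp_arrival_sub (β := β) l
  have hb0 := integral_sub_self (integrable_ite_ne_zero (β := β) 1 0)
  have hs := memLp_pow_sub (σ := σ) hq.le hq1 sg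
  have hs0 := integral_sub_self (integrable_pow (σ := σ) hq.le hq1)
  filter_upwards [hW, ae_one_le_vacations hν1, ae_tendsto_since_div a₀ h0 h1.le,
    ae_meanTendsto_arrival_service h0 h1.le hσ,
    ae_meanTendsto_vacations a₀ h0 h1.le hV hV0 bound1,
    ae_meanTendsto_vacations a₀ h0 h1.le hV hV0 bound2,
    ae_meanTendsto_vacations a₀ h0 h1.le hw hw0 bound1,
    ae_meanTendsto_vacations a₀ h0 h1.le hw hw0 bound2,
    ae_meanTendsto_arrivals a₀ h0 h1.le hb hb0 bound3,
    ae_meanTendsto_arrivals a₀ h0 h1.le hb hb0 bound4,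
    ae_meanTendsto_services a₀ h0 h1.le hs hs0 bound5] with e g1 g2 g3 g4 g5 g6 g7 g8 g9 g10 g11
  refine meanTendsto_elapsed_mul_vacation g2 a₀ hq rfl h0 hsg0
    (integral_pow_lt_one hq.le (by linarith) hν1) hv g1 g3 g4 g5 g6 g7 g8 (g9.congr fun t => ?_)
    (g10.congr fun t => ?_) g11
  · simp only [arrivals_eq_true_iff]
    rfl
  · simp only [arrivals_eq_true_iff]
    rfl

end Almost

end BerGV

/-! ### Regeneration at the zeros of the workload -/

namespace BerGV

open Topology

/-- The input seen from slot `n` on. -/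
def shift (n : ℕ) (e : Idx → ℕ) : Idx → ℕ :=
  fun i => e (Sum.map (n + ·) (Sum.map (n + ·) (n + ·)) i)

/-- The first positive slot at the beginning of which the workload vanishes. -/
noncomputable def cycleLength (e : Idx → ℕ) : ℕ := sInf {t | 1 ≤ t ∧ work t e = 0}

/-- The input seen from the end of the first cycle on. -/
noncomputable def renew (e : Idx → ℕ) : Idx → ℕ := shift (cycleLength e) e

lemma work_shift {n : ℕ} {e : Idx → ℕ} (h : work n e = 0) (t : ℕ) :
    work t (shift n e) = work (n + t) e := by
  induction t with
  | zero => exact h.symm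
  | succ t ih =>
    unfold work at ih ⊢
    rw [← add_assoc, workload, workload, ih]
    rfl

/-- If the workload never returns to zero, `cycleLength` has the default value 0, where the workload
vanishes by definition; hence no case distinction is needed later. -/
lemma work_cycleLength (e : Idx → ℕ) : work (cycleLength e) e = 0 := by
  by_cases h : {t | 1 ≤ t ∧ work t e = 0}.Nonempty
  · exact (Nat.sInf_mem h).2
  · rw [cycleLength, Set.not_nonempty_iff_eq_empty.1 h, Nat.sInf_empty]
    rfl

lemma cycleLength_eq_iff {e : Idx → ℕ} {n : ℕ} (hn : 1 ≤ n) :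
    cycleLength e = n ↔ work n e = 0 ∧ ∀ s, 1 ≤ s → s < n → work s e ≠ 0 := by
  constructor
  · rintro rfl
    refine ⟨work_cycleLength e, fun s hs hlt h => ?_⟩
    exact Nat.notMem_of_lt_sInf hlt ⟨hs, h⟩
  · rintro ⟨h1, h2⟩
    refine le_antisymm (Nat.sInf_le ⟨hn, h1⟩) (le_csInf ⟨n, hn, h1⟩ fun s hs => ?_)
    by_contra hlt
    exact h2 s hs.1 (not_le.1 hlt) hs.2

/-- The stopping time property, strict: the length `n` is decided by the slots before `n`, hence
independent of `shift n`. -/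
lemma dependsOn_cycleLength_eq {n : ℕ} (hn : 1 ≤ n) :
    DependsOn (fun e => cycleLength e = n) (past n) := by
  intro x y h
  have h1 : ∀ s ≤ n, work s x = work s y := fun s hs =>
    (dependsOn_work s).mono (past_mono hs) h
  simp only [cycleLength_eq_iff hn, h1 n le_rfl]
  refine propext (and_congr_right fun _ => forall_congr' fun s => forall_congr' fun _ =>
    forall_congr' fun hs => ?_)
  rw [h1 s hs.le]

lemma measurable_cycleLength : Measurable cycleLength := by
  have h1 : ∀ n, 1 ≤ n → MeasurableSet (cycleLength ⁻¹' {n}) := fun n hn =>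
    measurableSet_setOfPred.2 (measurable_of_dependsOn (past_finite n) (dependsOn_cycleLength_eq hn))
  refine measurable_to_countable' fun n => ?_
  rcases n.eq_zero_or_pos with rfl | hn
  · have : cycleLength ⁻¹' {0} = (⋃ n, cycleLength ⁻¹' {n + 1})ᶜ := by
      ext e
      simp only [Set.mem_preimage, Set.mem_singleton_iff, Set.mem_compl_iff, Set.mem_iUnion,
        not_exists]
      constructor
      · intro h n
        omega
      · intro h
        by_contra h0
        exact h (cycleLength e - 1) (by omega)
    rw [this]
    exact (MeasurableSet.iUnion fun n => h1 (n + 1) (by omega)).compl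
  · exact h1 n hn

lemma measurable_shift (n : ℕ) : Measurable (shift n) :=
  measurable_pi_lambda _ fun _ => measurable_pi_apply _

lemma measurable_renew : Measurable renew := by
  have h : Measurable fun p : ℕ × (Idx → ℕ) => shift p.1 p.2 :=
    measurable_from_prod_countable_right measurable_shift
  exact h.comp (measurable_cycleLength.prodMk measurable_id)

lemma dependsOn_shift (n : ℕ) : DependsOn (shift n) (past n)ᶜ := by
  intro x y h
  funext i
  refine h _ ?_
  simp only [Set.mem_compl_iff, mem_past_iff, not_lt]
  rcases i with i | i | i <;> exact Nat.le_add_right _ _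

/-- The sum of `g` over the first cycle. -/
noncomputable def cycleSum (g : ℕ → (Idx → ℕ) → ℕ) (e : Idx → ℕ) : ℕ :=
  ∑ t ∈ Finset.range (cycleLength e), g t e

lemma cycleLength_eq_cycleSum : cycleLength = cycleSum fun _ _ => 1 := by
  funext e
  simp [cycleSum]

section Renewal

variable {β σ ν : Measure ℕ} [IsProbabilityMeasure β] [IsProbabilityMeasure σ]
  [IsProbabilityMeasure ν]

lemma measurePreserving_shift (n : ℕ) :
    MeasurePreserving (shift n) (inputMeasure β σ ν) (inputMeasure β σ ν) := by
  refine ⟨measurable_shift n, ?_⟩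
  have hinj : Function.Injective
      (Sum.map (n + ·) (Sum.map (n + ·) (n + ·)) : Idx → Idx) :=
    (add_right_injective n).sumMap ((add_right_injective n).sumMap (add_right_injective n))
  have := Measure.map_infinitePi_infinitePi_of_inj (P := inputLaw β σ ν) hinj
  refine this.trans ?_
  congr 1
  funext i
  rcases i with i | i | i <;> rfl

variable {g : ℕ → (Idx → ℕ) → ℕ}

lemma dependsOn_cycleSum (hg : ∀ t, DependsOn (g t) (past (t + 1))) {n : ℕ} (hn : 1 ≤ n)
    (A : Set ℕ) : DependsOn (fun e => cycleLength e = n ∧ cycleSum g e ∈ A) (past n) := by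
  intro x y h
  have h1 : (cycleLength x = n) = (cycleLength y = n) := dependsOn_cycleLength_eq hn h
  simp only [h1]
  refine propext (and_congr_right fun hy => ?_)
  have hx : cycleLength x = n := h1.mpr hy
  rw [cycleSum, cycleSum, hx, hy]
  have : ∑ t ∈ Finset.range n, g t x = ∑ t ∈ Finset.range n, g t y :=
    Finset.sum_congr rfl fun t ht => (hg t).mono (past_mono (Finset.mem_range.1 ht)) h
  rw [this]

lemma measurable_cycleSum (hg : ∀ t, DependsOn (g t) (past (t + 1))) :
    Measurable (cycleSum g) := by
  have h : Measurable fun p : ℕ × (Idx → ℕ) => ∑ t ∈ Finset.range p.1, g t p.2 :=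
    measurable_from_prod_countable_right fun n => by
      have hgm : ∀ t, Measurable (g t) := fun t => measurable_of_dependsOn (past_finite _) (hg t)
      exact Finset.measurable_sum (Finset.range n) fun t _ => hgm t
  exact h.comp (measurable_cycleLength.prodMk measurable_id)

/-- The first cycle is independent of what follows, and what follows has the original law. -/
lemma measure_cycleSum_inter_renew (hfin : ∀ᵐ e ∂(inputMeasure β σ ν), 1 ≤ cycleLength e)
    (hg : ∀ t, DependsOn (g t) (past (t + 1))) (A : Set ℕ) {C : Set (Idx → ℕ)}
    (hC : MeasurableSet C) :
    (inputMeasure β σ ν) (cycleSum g ⁻¹' A ∩ renew ⁻¹' C) =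
      (inputMeasure β σ ν) (cycleSum g ⁻¹' A) * (inputMeasure β σ ν) C := by
  set Q := inputMeasure β σ ν with hQ
  -- Split according to the length of the cycle. Given length `n`, the cycle sum depends on the
  -- slots before `n` and `renew` is `shift n`.
  have hdec : ∀ D : Set (Idx → ℕ), Q D = ∑' n, Q (D ∩ cycleLength ⁻¹' {n}) := by
    intro D
    have := measure_iUnion (μ := Q.restrict D) (f := fun n : ℕ => cycleLength ⁻¹' {n})
      (fun m n hmn => Set.disjoint_left.2 fun e hm hn => hmn (by
        simp only [Set.mem_preimage, Set.mem_singleton_iff] at hm hn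
        omega)) fun n => measurable_cycleLength (measurableSet_singleton n)
    have hun : (⋃ n : ℕ, cycleLength ⁻¹' {n}) = Set.univ := by
      ext e; simp
    rw [hun, Measure.restrict_apply_univ] at this
    rw [this]
    refine tsum_congr fun n => ?_
    rw [Measure.restrict_apply (measurable_cycleLength (measurableSet_singleton n)),
      Set.inter_comm]
  rw [hdec (_ ∩ _), hdec (cycleSum g ⁻¹' A), ← ENNReal.tsum_mul_right]
  refine tsum_congr fun n => ?_
  rcases n.eq_zero_or_pos with rfl | hn
  · have h0 : ∀ D : Set (Idx → ℕ), Q (D ∩ cycleLength ⁻¹' {0}) = 0 := fun D => by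
      refine measure_mono_null (fun e he => ?_) hfin
      have h2 : cycleLength e = 0 := he.2
      simp [h2]
    rw [h0, h0, zero_mul]
  · have hind := indepFun_of_dependsOn (inputLaw β σ ν)
      (measurable_of_dependsOn (past_finite n) (dependsOn_cycleSum hg hn A)) (measurable_shift n)
      disjoint_compl_right (dependsOn_cycleSum hg hn A) (dependsOn_shift n)
    have := hind.measure_inter_preimage_eq_mul {True} C (measurableSet_singleton _) hC
    rw [(measurePreserving_shift n).measure_preimage hC.nullMeasurableSet] at this
    have h1 : (fun e => cycleLength e = n ∧ cycleSum g e ∈ A) ⁻¹' {True} =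
        cycleSum g ⁻¹' A ∩ cycleLength ⁻¹' {n} := by
      ext e
      simp [and_comm]
    rw [h1] at this
    rw [← this]
    congr 1
    ext e
    simp only [Set.mem_inter_iff, Set.mem_preimage, Set.mem_singleton_iff]
    constructor
    · rintro ⟨⟨h1, h2⟩, h3⟩
      refine ⟨⟨h1, h3⟩, ?_⟩
      rwa [renew, h3] at h2
    · rintro ⟨⟨h1, h3⟩, h2⟩
      refine ⟨⟨h1, ?_⟩, h3⟩
      rwa [renew, h3]

lemma measurePreserving_renew (hfin : ∀ᵐ e ∂(inputMeasure β σ ν), 1 ≤ cycleLength e) :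
    MeasurePreserving renew (inputMeasure β σ ν) (inputMeasure β σ ν) := by
  refine ⟨measurable_renew, Measure.ext fun C hC => ?_⟩
  rw [Measure.map_apply measurable_renew hC]
  have := measure_cycleSum_inter_renew hfin (g := fun _ _ => 0)
    (fun t => fun _ _ _ => rfl) Set.univ hC
  simpa using this

/-- The strong law of large numbers for cycle sums. -/
lemma ae_tendsto_cycleSum (hfin : ∀ᵐ e ∂(inputMeasure β σ ν), 1 ≤ cycleLength e)
    (hg : ∀ t, DependsOn (g t) (past (t + 1)))
    (hint : Integrable (fun e => (cycleSum g e : ℝ)) (inputMeasure β σ ν)) :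
    ∀ᵐ e ∂(inputMeasure β σ ν), MeanTendsto (fun k => (cycleSum g (renew^[k] e) : ℝ))
      (∫ e, (cycleSum g e : ℝ) ∂(inputMeasure β σ ν)) := by
  have hmp := measurePreserving_renew hfin
  have hm := measurable_cycleSum hg
  have hmr : Measurable fun e => (cycleSum g e : ℝ) := (measurable_of_countable _).comp hm
  -- Pairwise independence suffices for the strong law. Applying `renew` `i` times preserves the
  -- measure and reduces to a first cycle and what follows.
  have hpair : ∀ i k, IndepFun (fun e => cycleSum g (renew^[i] e))
      (fun e => cycleSum g (renew^[i + (k + 1)] e)) (inputMeasure β σ ν) := by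
    intro i k
    rw [indepFun_iff_measure_inter_preimage_eq_mul]
    intro A C hA hC
    have h1 : MeasurableSet ((fun e => cycleSum g (renew^[k] e)) ⁻¹' C) :=
      (hm.comp (measurable_renew.iterate k)) hC
    have h2 := measure_cycleSum_inter_renew hfin hg A h1
    have h3 : (fun e => cycleSum g (renew^[i] e)) ⁻¹' A ∩
        (fun e => cycleSum g (renew^[i + (k + 1)] e)) ⁻¹' C =
        renew^[i] ⁻¹' (cycleSum g ⁻¹' A ∩
          renew ⁻¹' ((fun e => cycleSum g (renew^[k] e)) ⁻¹' C)) := by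
      ext e
      simp only [Set.mem_inter_iff, Set.mem_preimage]
      rw [add_comm i (k + 1), Function.iterate_add_apply, Function.iterate_succ_apply]
    have h4 : (fun e => cycleSum g (renew^[i + (k + 1)] e)) ⁻¹' C =
        renew^[i + 1] ⁻¹' ((fun e => cycleSum g (renew^[k] e)) ⁻¹' C) := by
      ext e
      simp only [Set.mem_preimage]
      rw [show i + (k + 1) = k + (i + 1) by ring, Function.iterate_add_apply]
    have h5 : (fun e => cycleSum g (renew^[i] e)) ⁻¹' A =
      renew^[i] ⁻¹' (cycleSum g ⁻¹' A) := rfl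
    rw [h3, (hmp.iterate i).measure_preimage
      ((hm hA).inter (measurable_renew h1)).nullMeasurableSet, h2, h4, h5,
      (hmp.iterate i).measure_preimage (hm hA).nullMeasurableSet,
      (hmp.iterate (i + 1)).measure_preimage h1.nullMeasurableSet]
  have hpair' : ∀ i j, i < j → IndepFun (fun e => (cycleSum g (renew^[i] e) : ℝ))
      (fun e => (cycleSum g (renew^[j] e) : ℝ)) (inputMeasure β σ ν) := by
    intro i j hij
    obtain ⟨k, rfl⟩ : ∃ k, j = i + (k + 1) := ⟨j - i - 1, by omega⟩
    exact (hpair i k).comp (measurable_of_countable (Nat.cast : ℕ → ℝ))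
      (measurable_of_countable (Nat.cast : ℕ → ℝ))
  refine strong_law_ae_real (fun k e => (cycleSum g (renew^[k] e) : ℝ)) hint ?_ ?_
  · intro i j hij
    rcases lt_or_gt_of_ne hij with h | h
    · exact hpair' i j h
    · exact (hpair' j i h).symm
  · intro i
    refine ⟨(hmr.comp (measurable_renew.iterate i)).aemeasurable, hmr.aemeasurable, ?_⟩
    have : (fun e => (cycleSum g (renew^[i] e) : ℝ)) =
      (fun e => (cycleSum g e : ℝ)) ∘ renew^[i] := rfl
    rw [this, ← Measure.map_map hmr (measurable_renew.iterate i), (hmp.iterate i).map_eq]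
    rfl

/-- The beginning of the `n`-th cycle. -/
noncomputable def epoch (e : Idx → ℕ) (n : ℕ) : ℕ :=
  ∑ k ∈ Finset.range n, cycleLength (renew^[k] e)

lemma sum_range_epoch (hflow : ∀ e s t, work s e = 0 → g t (shift s e) = g (s + t) e)
    (e : Idx → ℕ) (n : ℕ) :
    ∑ t ∈ Finset.range (epoch e n), g t e = ∑ k ∈ Finset.range n, cycleSum g (renew^[k] e) := by
  induction n generalizing e with
  | zero => simp [epoch]
  | succ n ih =>
    have h1 : epoch e (n + 1) = cycleLength e + epoch (renew e) n := by
      rw [epoch, Finset.sum_range_succ', add_comm]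
      rfl
    rw [h1, Finset.sum_range_add, Finset.sum_range_succ', add_comm]
    congr 1
    simp only [Function.iterate_succ_apply]
    rw [← ih]
    exact Finset.sum_congr rfl fun t _ => (hflow e _ t (work_cycleLength e)).symm

/-- The regenerative strong law of large numbers. -/
theorem ae_meanTendsto_of_cycleSum (hfin : ∀ᵐ e ∂(inputMeasure β σ ν), 1 ≤ cycleLength e)
    (hτ : Integrable (fun e => (cycleLength e : ℝ)) (inputMeasure β σ ν))
    (hg : ∀ t, DependsOn (g t) (past (t + 1)))
    (hflow : ∀ e s t, work s e = 0 → g t (shift s e) = g (s + t) e)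
    (hint : Integrable (fun e => (cycleSum g e : ℝ)) (inputMeasure β σ ν)) :
    ∀ᵐ e ∂(inputMeasure β σ ν), MeanTendsto (fun t => (g t e : ℝ))
      ((∫ e, (cycleSum g e : ℝ) ∂(inputMeasure β σ ν)) /
        ∫ e, (cycleLength e : ℝ) ∂(inputMeasure β σ ν)) := by
  have h1 : 1 ≤ ∫ e, (cycleLength e : ℝ) ∂(inputMeasure β σ ν) := by
    calc (1 : ℝ) = ∫ _, 1 ∂(inputMeasure β σ ν) := by simp
      _ ≤ _ := by
        refine integral_mono_ae (integrable_const _) hτ ?_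
        filter_upwards [hfin] with e he
        exact_mod_cast he
  have hlen := ae_tendsto_cycleSum (g := fun _ _ => 1) hfin (fun _ _ _ _ => rfl)
    (by rwa [← cycleLength_eq_cycleSum])
  rw [← cycleLength_eq_cycleSum] at hlen
  set m := ∫ e, (cycleLength e : ℝ) ∂(inputMeasure β σ ν) with hm
  have hm0 : 0 < m := by linarith
  filter_upwards [hlen, ae_tendsto_cycleSum hfin hg hint] with e he hge
  have hT : ∀ n, (epoch e n : ℝ) = ∑ k ∈ Finset.range n, (cycleLength (renew^[k] e) : ℝ) :=
    fun n => by rw [epoch]; push_cast; rfl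
  have hTn : Tendsto (fun n : ℕ => (epoch e n : ℝ) / n) atTop (𝓝 m) := by
    simp_rw [hT]
    exact he
  have htop : Tendsto (epoch e) atTop atTop := by
    have h2 : Tendsto (fun n : ℕ => (epoch e n : ℝ) / n * n) atTop atTop :=
      hTn.pos_mul_atTop hm0 tendsto_natCast_atTop_atTop
    refine tendsto_natCast_atTop_iff (R := ℝ) |>.1 (h2.congr' ?_)
    filter_upwards [eventually_gt_atTop 0] with n hn
    field_simp
  -- The partial sums are monotone and the ratio of consecutive epochs tends to 1, so convergence
  -- along the epochs implies convergence.
  refine tendsto_div_of_monotone_of_exists_subseq_tendsto_div _ _ ?_ fun a ha =>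
    ⟨epoch e, ?_, htop, ?_⟩
  · exact monotone_nat_of_le_succ fun n => by
      rw [Finset.sum_range_succ]
      exact le_add_of_nonneg_right (Nat.cast_nonneg _)
  · have h3 : Tendsto (fun n : ℕ => a * ((epoch e n : ℝ) / n) -
        ((epoch e n : ℝ) / n + (cycleLength (renew^[n] e) : ℝ) / n)) atTop
        (𝓝 (a * m - (m + 0))) :=
      (hTn.const_mul a).sub (hTn.add he.tendsto_div)
    have h4 : 0 < a * m - (m + 0) := by nlinarith
    filter_upwards [h3.eventually (lt_mem_nhds h4), eventually_gt_atTop 0] with n hn hn0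
    have h5 : (epoch e (n + 1) : ℝ) = epoch e n + cycleLength (renew^[n] e) := by
      rw [hT, hT, Finset.sum_range_succ]
    have h6 : (0 : ℝ) < n := by exact_mod_cast hn0
    rw [h5]
    have h7 : a * ((epoch e n : ℝ) / n) -
        ((epoch e n : ℝ) / n + (cycleLength (renew^[n] e) : ℝ) / n) =
        (a * epoch e n - (epoch e n + cycleLength (renew^[n] e))) / n := by
      field_simp
    rw [h7] at hn
    have := (div_pos_iff_of_pos_right h6).1 hn
    linarith
  · refine (Tendsto.div hge hTn hm0.ne').congr' ?_
    filter_upwards [eventually_gt_atTop 0] with n hn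
    have h0 : (n : ℝ) ≠ 0 := by positivity
    simp only [Pi.div_apply]
    rw [div_div_div_cancel_right₀ h0]
    congr 1
    exact_mod_cast (sum_range_epoch hflow e n).symm

end Renewal

end BerGV

/-! ### Balance equations over a cycle -/

namespace BerGV

open Topology ENNReal

/-- The indicator that the first cycle is longer than `t`. -/
def live : ℕ → (Idx → ℕ) → ℕ
  | 0, _ => 1
  | t + 1, e => if work (t + 1) e = 0 then 0 else live t e

/-- The vacation that starts in slot `t`, if there is one. -/
def idle (t : ℕ) (e : Idx → ℕ) : ℕ := if work t e = 0 then vacations e t else 0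

/-- The work left at the end of slot `t`, before arrivals. -/
def leftover (t : ℕ) (e : Idx → ℕ) : ℕ := afterSlot (work t e) (vacations e t)

/-- The number of arrivals in slot `t`. -/
def arrival (t : ℕ) (e : Idx → ℕ) : ℕ := if e (.inl t) ≠ 0 then 1 else 0

lemma dependsOn_live (t : ℕ) : DependsOn (live t) (past t) := by
  induction t with
  | zero => intro x y _; rfl
  | succ t ih =>
    intro x y h
    rw [live, live, dependsOn_work (t + 1) h, ih.mono (past_mono t.le_succ) h]

lemma live_le_one (t : ℕ) (e : Idx → ℕ) : live t e ≤ 1 := by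
  induction t with
  | zero => exact le_rfl
  | succ t ih =>
    rw [live]
    split_ifs
    · exact zero_le_one
    · exact ih

lemma live_eq_one_iff {t : ℕ} {e : Idx → ℕ} :
    live t e = 1 ↔ ∀ s, 1 ≤ s → s ≤ t → work s e ≠ 0 := by
  induction t with
  | zero => exact ⟨fun _ s h1 h2 => by omega, fun _ => rfl⟩
  | succ t ih =>
    rw [live]
    split_ifs with h
    · exact ⟨fun h2 => by simp at h2, fun h2 => absurd h (h2 (t + 1) (by omega) le_rfl)⟩
    · rw [ih]
      refine ⟨fun h2 s h3 h4 => ?_, fun h2 s h3 h4 => h2 s h3 (by omega)⟩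
      rcases Nat.le_succ_iff.1 h4 with h5 | rfl
      · exact h2 s h3 h5
      · exact h

lemma live_eq_of_one_le {e : Idx → ℕ} (h : 1 ≤ cycleLength e) (t : ℕ) :
    live t e = if t < cycleLength e then 1 else 0 := by
  obtain ⟨h1, h2⟩ := (cycleLength_eq_iff h).1 rfl
  split_ifs with h3
  · exact live_eq_one_iff.2 fun s hs hst => h2 s hs (by omega)
  · have h4 : live t e ≠ 1 := fun h5 => live_eq_one_iff.1 h5 _ h (by omega) h1
    have := live_le_one t e
    omega

lemma one_le_cycleLength_of_live_eq_zero {e : Idx → ℕ} {t : ℕ} (h : live t e = 0) :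
    1 ≤ cycleLength e := by
  have h1 : ∃ s, 1 ≤ s ∧ work s e = 0 := by
    by_contra h2
    push Not at h2
    rw [live_eq_one_iff.2 fun s hs _ => h2 s hs] at h
    exact one_ne_zero h
  exact (Nat.sInf_mem (s := {t | 1 ≤ t ∧ work t e = 0}) h1).1

/-- Within a cycle a vacation starts only in slot 0, so a cycle contains exactly one vacation. -/
lemma live_mul_idle (t : ℕ) (e : Idx → ℕ) :
    live t e * (if work t e = 0 then 1 else 0) = if t = 0 then 1 else 0 := by
  cases t with
  | zero => rfl
  | succ t =>
    rw [live]
    split_ifs <;> simp_all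

/-- The cycle ends at workload zero, so stopping it discards nothing from positive powers of the
workload; the balances telescope. -/
lemma live_succ_mul_work (t k : ℕ) (e : Idx → ℕ) :
    live (t + 1) e * work (t + 1) e ^ (k + 1) = live t e * work (t + 1) e ^ (k + 1) := by
  rw [live]
  split_ifs with h <;> simp [h]

lemma cycleSum_eq_sum_live {e : Idx → ℕ} (h : 1 ≤ cycleLength e) (f : ℕ → (Idx → ℕ) → ℕ) :
    cycleSum f e = ∑ t ∈ Finset.range (cycleLength e), live t e * f t e := by
  refine Finset.sum_congr rfl fun t ht => ?_
  rw [live_eq_of_one_le h, if_pos (Finset.mem_range.1 ht), one_mul]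

section Path

variable {e : Idx → ℕ}

lemma work_succ (t : ℕ) : work (t + 1) e = leftover t e + arrival t e * services e t := by
  unfold work leftover arrival
  rw [workload]
  simp only [arrivals_eq_true_iff]
  split_ifs <;> simp <;> rfl

lemma leftover_add_one (hV : ∀ t, 1 ≤ vacations e t) (t : ℕ) :
    leftover t e + 1 = work t e + idle t e :=
  workload_succ_add_one hV t

/-- The balance of the workload over a cycle. -/
lemma live_mul_work_add_sum (hV : ∀ t, 1 ≤ vacations e t) (N : ℕ) :
    live N e * work N e + ∑ n ∈ Finset.range N, live n e * 1 =
      ∑ n ∈ Finset.range N, live n e * (idle n e + arrival n e * services e n) := by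
  induction N with
  | zero => simp [work, workload]
  | succ N ih =>
    have h1 := live_succ_mul_work N 0 e
    simp only [zero_add, pow_one] at h1
    rw [Finset.sum_range_succ, Finset.sum_range_succ, ← ih, h1]
    have h2 : live N e * work (N + 1) e + live N e * 1 = live N e * work N e +
        live N e * (idle N e + arrival N e * services e N) := by
      rw [← mul_add, ← mul_add, work_succ, ← add_assoc, ← leftover_add_one hV]
      ring
    omega

/-- The balance of the square of the workload over a cycle. -/
lemma live_mul_work_sq_add_sum (hV : ∀ t, 1 ≤ vacations e t) (N : ℕ) :
    live N e * work N e ^ 2 +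
        ∑ n ∈ Finset.range N, live n e * ((work n e + idle n e) + (work n e + idle n e)) =
      ∑ n ∈ Finset.range N, live n e * ((leftover n e * (arrival n e * services e n) +
        leftover n e * (arrival n e * services e n)) +
        (arrival n e * services e n ^ 2 + (1 + idle n e ^ 2))) := by
  induction N with
  | zero => simp [work, workload]
  | succ N ih =>
    have h1 : live (N + 1) e * work (N + 1) e ^ 2 = live N e * work (N + 1) e ^ 2 :=
      live_succ_mul_work N 1 e
    rw [Finset.sum_range_succ, Finset.sum_range_succ, ← ih, h1]
    have ha : arrival N e ^ 2 = arrival N e := by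
      unfold arrival; split_ifs <;> rfl
    have h3 : (work N e + idle N e) ^ 2 = work N e ^ 2 + idle N e ^ 2 := by
      unfold idle; split_ifs with h <;> simp [h]
    -- Square the recursion `W (N + 1) = R + b * S`, with `b` the arrival, using `(R + 1) ^ 2 = W ^
    -- 2 + I ^ 2` and `b ^ 2 = b`. Here `I = idle`, so `W * I = 0`. Terms are arranged to avoid
    -- subtraction.
    have h4 : work (N + 1) e ^ 2 + ((work N e + idle N e) + (work N e + idle N e)) =
        work N e ^ 2 + ((leftover N e * (arrival N e * services e N) +
        leftover N e * (arrival N e * services e N)) +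
        (arrival N e * services e N ^ 2 + (1 + idle N e ^ 2))) := by
      have h5 : work N e ^ 2 + ((leftover N e * (arrival N e * services e N) +
        leftover N e * (arrival N e * services e N)) +
        (arrival N e * services e N ^ 2 + (1 + idle N e ^ 2))) = (work N e ^ 2 + idle N e ^ 2) +
          2 * (leftover N e * (arrival N e * services e N)) +
          arrival N e * services e N ^ 2 + 1 := by ring
      rw [h5, ← h3, work_succ, ← leftover_add_one hV]
      calc _ = (leftover N e + 1) ^ 2 + 2 * (leftover N e * (arrival N e * services e N)) +
            arrival N e ^ 2 * services e N ^ 2 + 1 := by ring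
        _ = _ := by rw [ha]
    have h2 := congrArg (live N e * ·) h4
    simp only [mul_add] at h2 ⊢
    omega

end Path

section Expectation

variable {β σ ν : Measure ℕ} [IsProbabilityMeasure β] [IsProbabilityMeasure σ]
  [IsProbabilityMeasure ν]

lemma measurable_natCast_of_dependsOn {f : (Idx → ℕ) → ℕ} {C : Set Idx} (hC : C.Finite)
    (hf : DependsOn f C) : Measurable fun e => (f e : ℝ≥0∞) :=
  (measurable_of_countable (Nat.cast : ℕ → ℝ≥0∞)).comp (measurable_of_dependsOn hC hf)

lemma lintegral_coord (ψ : ℕ → ℝ≥0∞) (i : Idx) :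
    ∫⁻ e, ψ (e i) ∂(inputMeasure β σ ν) = ∫⁻ x, ψ x ∂(inputLaw β σ ν i) := by
  have hmp := measurePreserving_eval_infinitePi (inputLaw β σ ν) i
  conv_rhs => rw [← hmp.map_eq]
  rw [lintegral_map (measurable_of_countable ψ) hmp.measurable]

lemma lintegral_mul_coord {f : (Idx → ℕ) → ℕ} {C : Set Idx} (hC : C.Finite)
    (hf : DependsOn f C) {i : Idx} (hi : i ∉ C) (ψ : ℕ → ℕ) :
    ∫⁻ e, ((f e * ψ (e i) : ℕ) : ℝ≥0∞) ∂(inputMeasure β σ ν) =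
      (∫⁻ e, (f e : ℝ≥0∞) ∂(inputMeasure β σ ν)) * ∫⁻ x, (ψ x : ℝ≥0∞) ∂(inputLaw β σ ν i) := by
  have hψ : Measurable fun e : Idx → ℕ => (ψ (e i) : ℝ≥0∞) :=
    (measurable_of_countable fun n : ℕ => (ψ n : ℝ≥0∞)).comp (measurable_pi_apply i)
  have hf' := measurable_natCast_of_dependsOn hC hf
  have hind := indepFun_of_dependsOn (inputLaw β σ ν) hf' hψ
    (Set.disjoint_singleton_right.2 hi) (fun _ _ h => congrArg _ (hf h))
    (dependsOn_coord (fun n => (ψ n : ℝ≥0∞)) i)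
  have := lintegral_mul_eq_lintegral_mul_lintegral_of_indepFun hf' hψ hind
  rw [lintegral_coord fun n => (ψ n : ℝ≥0∞)] at this
  rw [← this]
  simp

/-- The probability of an arrival, as an extended nonnegative real number. -/
noncomputable def erate (β : Measure ℕ) : ℝ≥0∞ := ∫⁻ n, ((if n ≠ 0 then 1 else 0 : ℕ) : ℝ≥0∞) ∂β

/-- The weight may use the vacation of slot `t` but neither the arrival nor the service time, so
both factor out. -/
lemma lintegral_mul_arrival {t : ℕ} {f : (Idx → ℕ) → ℕ}
    (hf : DependsOn f (insert (.inr (.inr t)) (past t))) (θ : ℕ → ℕ) :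
    ∫⁻ e, ((f e * (arrival t e * θ (services e t)) : ℕ) : ℝ≥0∞) ∂(inputMeasure β σ ν) =
      erate β * (∫⁻ n, (θ n : ℝ≥0∞) ∂σ) * ∫⁻ e, (f e : ℝ≥0∞) ∂(inputMeasure β σ ν) := by
  have hfin : (insert (.inr (.inr t)) (past t) : Set Idx).Finite := (past_finite t).insert _
  have hd : DependsOn (fun e => f e * arrival t e)
      (insert (.inl t) (insert (.inr (.inr t)) (past t))) := by
    refine dependsOn_op _ (hf.mono (Set.subset_insert _ _)) fun x y h => ?_
    unfold arrival
    rw [h _ (Set.mem_insert _ _)]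
  have h1 := lintegral_mul_coord (β := β) (σ := σ) (ν := ν) (hfin.insert _) hd
    (i := .inr (.inl t)) (by
      rintro (h | h | h)
      · cases h
      · cases h
      · exact lt_irrefl t h) θ
  have h2 := lintegral_mul_coord (β := β) (σ := σ) (ν := ν) hfin hf
    (i := .inl t) (by
      rintro (h | h)
      · cases h
      · exact lt_irrefl t h) fun n => if n ≠ 0 then 1 else 0
  simp_rw [← mul_assoc]
  refine h1.trans ?_
  unfold arrival
  rw [h2]
  simp only [inputLaw, Sum.elim_inl, Sum.elim_inr, erate]
  ring

lemma dependsOn_leftover (t : ℕ) : DependsOn (leftover t) (insert (.inr (.inr t)) (past t)) :=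
  dependsOn_op afterSlot ((dependsOn_work t).mono (Set.subset_insert _ _))
    fun _ _ h => h _ (Set.mem_insert _ _)

lemma dependsOn_live' (t : ℕ) : DependsOn (live t) (insert (.inr (.inr t)) (past t)) :=
  (dependsOn_live t).mono (Set.subset_insert _ _)

lemma dependsOn_idle (t : ℕ) : DependsOn (idle t) (insert (.inr (.inr t)) (past t)) :=
  dependsOn_op (fun w v => if w = 0 then v else 0)
    ((dependsOn_work t).mono (Set.subset_insert _ _)) fun _ _ h => h _ (Set.mem_insert _ _)

lemma lintegral_live_mul_idle_pow (t k : ℕ) :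
    ∫⁻ e, ((live t e * idle t e ^ (k + 1) : ℕ) : ℝ≥0∞) ∂(inputMeasure β σ ν) =
      if t = 0 then ∫⁻ n, ((n ^ (k + 1) : ℕ) : ℝ≥0∞) ∂ν else 0 := by
  have h1 : ∀ e, live t e * idle t e ^ (k + 1) =
      if t = 0 then vacations e t ^ (k + 1) else 0 := by
    intro e
    have : idle t e ^ (k + 1) = (if work t e = 0 then 1 else 0) * vacations e t ^ (k + 1) := by
      unfold idle; split_ifs <;> simp
    rw [this, ← mul_assoc, live_mul_idle]
    split_ifs <;> simp
  simp_rw [h1]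
  split_ifs with h
  · exact lintegral_coord (fun n => ((n ^ (k + 1) : ℕ) : ℝ≥0∞)) (.inr (.inr t))
  · simp

/-- The expected sum of `f` over the first cycle, slot by slot. -/
noncomputable def slotMean (β σ ν : Measure ℕ) [IsProbabilityMeasure β] [IsProbabilityMeasure σ]
    [IsProbabilityMeasure ν] (f : ℕ → (Idx → ℕ) → ℕ) (t : ℕ) : ℝ≥0∞ :=
  ∫⁻ e, ((live t e * f t e : ℕ) : ℝ≥0∞) ∂(inputMeasure β σ ν)

lemma lintegral_cycleSum (hfin : ∀ᵐ e ∂(inputMeasure β σ ν), 1 ≤ cycleLength e)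
    {f : ℕ → (Idx → ℕ) → ℕ} (hf : ∀ t, DependsOn (f t) (past (t + 1))) :
    ∫⁻ e, (cycleSum f e : ℝ≥0∞) ∂(inputMeasure β σ ν) = ∑' t, slotMean β σ ν f t := by
  unfold slotMean
  rw [← lintegral_tsum fun t => (measurable_natCast_of_dependsOn (past_finite (t + 1))
    (dependsOn_op _ ((dependsOn_live t).mono (past_mono t.le_succ)) (hf t))).aemeasurable]
  refine lintegral_congr_ae ?_
  filter_upwards [hfin] with e he
  rw [tsum_eq_sum (s := Finset.range (cycleLength e)), cycleSum_eq_sum_live he]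
  · push_cast
    rfl
  · intro t ht
    rw [live_eq_of_one_le he, if_neg (by simpa using ht)]
    simp

lemma le_div_of_le_mul_add {a r c : ℝ≥0∞} (ha : a ≠ ∞) (hr : r < 1) (h : a ≤ r * a + c) :
    a ≤ c / (1 - r) := by
  have h1 : 1 - r ≠ 0 := (tsub_pos_of_lt hr).ne'
  rw [ENNReal.le_div_iff_mul_le (.inl h1) (.inl (by finiteness)),
    ENNReal.mul_sub fun _ _ => ha, mul_one]
  rw [tsub_le_iff_left, mul_comm a r]
  exact h

lemma past_insert_subset (t : ℕ) : insert (.inr (.inr t)) (past t) ⊆ past (t + 1) :=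
  Set.insert_subset (Nat.lt_succ_self t) (past_mono t.le_succ)

lemma measurable_live_mul {t : ℕ} {f : (Idx → ℕ) → ℕ} (hf : DependsOn f (past (t + 1))) :
    Measurable fun e => ((live t e * f e : ℕ) : ℝ≥0∞) :=
  measurable_natCast_of_dependsOn (past_finite (t + 1))
    (dependsOn_op _ ((dependsOn_live t).mono (past_mono t.le_succ)) hf)

lemma dependsOn_arrival (t : ℕ) : DependsOn (arrival t) (past (t + 1)) := by
  intro x y h
  unfold arrival
  rw [h (.inl t) (Nat.lt_succ_self t)]

lemma dependsOn_services (t : ℕ) : DependsOn (fun e => services e t) (past (t + 1)) :=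
  fun _ _ h => h (.inr (.inl t)) (Nat.lt_succ_self t)

lemma slotMean_one_le (t : ℕ) : slotMean β σ ν (fun _ _ => 1) t ≤ 1 := by
  calc _ ≤ ∫⁻ _, 1 ∂(inputMeasure β σ ν) := lintegral_mono fun e => by
        rw [mul_one]
        exact (Nat.cast_le.2 (live_le_one t e)).trans Nat.cast_one.le
    _ = 1 := by simp

lemma slotMean_idle (t : ℕ) : slotMean β σ ν idle t = if t = 0 then ∫⁻ n, (n : ℝ≥0∞) ∂ν else 0 := by
  unfold slotMean
  simpa using lintegral_live_mul_idle_pow (β := β) (σ := σ) (ν := ν) t 0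

lemma slotMean_idle_sq (t : ℕ) : slotMean β σ ν (fun t e => idle t e ^ 2) t =
    if t = 0 then ∫⁻ n, ((n ^ 2 : ℕ) : ℝ≥0∞) ∂ν else 0 :=
  lintegral_live_mul_idle_pow t 1

lemma slotMean_arrival_mul (θ : ℕ → ℕ) (t : ℕ) :
    slotMean β σ ν (fun t e => arrival t e * θ (services e t)) t =
      erate β * (∫⁻ n, (θ n : ℝ≥0∞) ∂σ) * slotMean β σ ν (fun _ _ => 1) t := by
  unfold slotMean
  rw [lintegral_mul_arrival (dependsOn_live' t)]
  simp

lemma slotMean_leftover_mul (θ : ℕ → ℕ) (t : ℕ) :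
    slotMean β σ ν (fun t e => leftover t e * (arrival t e * θ (services e t))) t =
      erate β * (∫⁻ n, (θ n : ℝ≥0∞) ∂σ) * slotMean β σ ν leftover t := by
  unfold slotMean
  rw [← lintegral_mul_arrival (dependsOn_op _ (dependsOn_live' t) (dependsOn_leftover t))]
  simp_rw [mul_assoc]

lemma slotMean_leftover (hV : ∀ᵐ e ∂(inputMeasure β σ ν), ∀ t, 1 ≤ vacations e t) (t : ℕ) :
    slotMean β σ ν leftover t + slotMean β σ ν (fun _ _ => 1) t =
      slotMean β σ ν work t + slotMean β σ ν idle t := by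
  unfold slotMean
  have hm : ∀ {f : (Idx → ℕ) → ℕ}, DependsOn f (past (t + 1)) →
    Measurable fun e => ((live t e * f e : ℕ) : ℝ≥0∞) := fun hf => measurable_live_mul hf
  rw [← lintegral_add_left (hm ((dependsOn_leftover t).mono (past_insert_subset t))),
    ← lintegral_add_left (hm ((dependsOn_work t).mono (past_mono t.le_succ)))]
  refine lintegral_congr_ae ?_
  filter_upwards [hV] with e he
  have := leftover_add_one he t
  norm_cast
  rw [← mul_add, ← mul_add, this]

lemma slotMean_add {f g : ℕ → (Idx → ℕ) → ℕ} {t : ℕ} (hf : DependsOn (f t) (past (t + 1))) :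
    slotMean β σ ν (fun t e => f t e + g t e) t = slotMean β σ ν f t + slotMean β σ ν g t := by
  unfold slotMean
  rw [← lintegral_add_left (measurable_live_mul hf)]
  refine lintegral_congr fun e => ?_
  norm_cast
  rw [mul_add]

lemma slotMean_balance {w f g : ℕ → (Idx → ℕ) → ℕ} {N : ℕ} (hw : DependsOn (w N) (past (N + 1)))
    (hf : ∀ t, DependsOn (f t) (past (t + 1))) (hg : ∀ t, DependsOn (g t) (past (t + 1)))
    (h : ∀ᵐ e ∂(inputMeasure β σ ν), live N e * w N e + ∑ n ∈ Finset.range N, live n e * f n e =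
      ∑ n ∈ Finset.range N, live n e * g n e) :
    slotMean β σ ν w N + ∑ n ∈ Finset.range N, slotMean β σ ν f n =
      ∑ n ∈ Finset.range N, slotMean β σ ν g n := by
  unfold slotMean
  rw [← lintegral_finsetSum _ fun n _ => measurable_live_mul (hf n),
    ← lintegral_finsetSum _ fun n _ => measurable_live_mul (hg n),
    ← lintegral_add_left (measurable_live_mul hw)]
  refine lintegral_congr_ae ?_
  filter_upwards [h] with e he
  exact_mod_cast he

/-- The vacation and the work that arrives in a slot. -/
def inflow (t : ℕ) (e : Idx → ℕ) : ℕ := idle t e + arrival t e * services e t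

/-- Twice the work in a slot. -/
def outflowSq (t : ℕ) (e : Idx → ℕ) : ℕ := (work t e + idle t e) + (work t e + idle t e)

/-- The increment of the square of the workload, without the terms of `outflowSq`. -/
def inflowSq (t : ℕ) (e : Idx → ℕ) : ℕ :=
  (leftover t e * (arrival t e * services e t) + leftover t e * (arrival t e * services e t)) +
    (arrival t e * services e t ^ 2 + (1 + idle t e ^ 2))

lemma dependsOn_work' (t : ℕ) : DependsOn (work t) (past (t + 1)) :=
  (dependsOn_work t).mono (past_mono t.le_succ)

lemma dependsOn_idle' (t : ℕ) : DependsOn (idle t) (past (t + 1)) :=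
  (dependsOn_idle t).mono (past_insert_subset t)

lemma dependsOn_leftover' (t : ℕ) : DependsOn (leftover t) (past (t + 1)) :=
  (dependsOn_leftover t).mono (past_insert_subset t)

lemma dependsOn_arrival_mul_services (t : ℕ) :
    DependsOn (fun e => arrival t e * services e t) (past (t + 1)) :=
  dependsOn_op _ (dependsOn_arrival t) (dependsOn_services t)

lemma dependsOn_arrival_mul_services_sq (t : ℕ) :
    DependsOn (fun e => arrival t e * services e t ^ 2) (past (t + 1)) :=
  dependsOn_op (fun a b => a * b ^ 2) (dependsOn_arrival t) (dependsOn_services t)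

lemma dependsOn_inflow (t : ℕ) : DependsOn (inflow t) (past (t + 1)) :=
  dependsOn_op (· + ·) (dependsOn_idle' t) (dependsOn_arrival_mul_services t)

lemma dependsOn_work_add_idle (t : ℕ) :
    DependsOn (fun e => work t e + idle t e) (past (t + 1)) :=
  dependsOn_op _ (dependsOn_work' t) (dependsOn_idle' t)

lemma dependsOn_outflowSq (t : ℕ) : DependsOn (outflowSq t) (past (t + 1)) :=
  dependsOn_op (· + ·) (dependsOn_work_add_idle t) (dependsOn_work_add_idle t)

lemma dependsOn_leftover_mul (t : ℕ) :
    DependsOn (fun e => leftover t e * (arrival t e * services e t)) (past (t + 1)) :=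
  dependsOn_op _ (dependsOn_leftover' t) (dependsOn_arrival_mul_services t)

lemma dependsOn_inflowSq (t : ℕ) : DependsOn (inflowSq t) (past (t + 1)) :=
  dependsOn_op (· + ·) (dependsOn_op (· + ·) (dependsOn_leftover_mul t) (dependsOn_leftover_mul t))
    (dependsOn_op (· + ·) (dependsOn_arrival_mul_services_sq t)
      (dependsOn_op (fun _ b => 1 + b ^ 2) (dependsOn_idle' t) (dependsOn_idle' t)))

lemma slotMean_inflow (t : ℕ) : slotMean β σ ν inflow t =
    (if t = 0 then ∫⁻ n, (n : ℝ≥0∞) ∂ν else 0) +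
      erate β * (∫⁻ n, (n : ℝ≥0∞) ∂σ) * slotMean β σ ν (fun _ _ => 1) t := by
  refine (slotMean_add (dependsOn_idle' t)).trans ?_
  rw [slotMean_idle]
  exact congrArg _ (slotMean_arrival_mul id t)

lemma slotMean_outflowSq (t : ℕ) : slotMean β σ ν outflowSq t =
    2 * (slotMean β σ ν work t + if t = 0 then ∫⁻ n, (n : ℝ≥0∞) ∂ν else 0) := by
  refine (slotMean_add (f := fun t e => work t e + idle t e)
    (g := fun t e => work t e + idle t e) (dependsOn_work_add_idle t)).trans ?_
  rw [slotMean_add (dependsOn_work' t), slotMean_idle, two_mul]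

lemma slotMean_inflowSq (t : ℕ) : slotMean β σ ν inflowSq t =
    2 * (erate β * (∫⁻ n, (n : ℝ≥0∞) ∂σ) * slotMean β σ ν leftover t) +
    (erate β * (∫⁻ n, ((n ^ 2 : ℕ) : ℝ≥0∞) ∂σ) * slotMean β σ ν (fun _ _ => 1) t +
    (slotMean β σ ν (fun _ _ => 1) t +
      if t = 0 then ∫⁻ n, ((n ^ 2 : ℕ) : ℝ≥0∞) ∂ν else 0)) := by
  refine (slotMean_add (f := fun t e => leftover t e * (arrival t e * services e t) +
    leftover t e * (arrival t e * services e t))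
    (g := fun t e => arrival t e * services e t ^ 2 + (1 + idle t e ^ 2))
    (dependsOn_op _ (dependsOn_leftover_mul t) (dependsOn_leftover_mul t))).trans ?_
  rw [slotMean_add (f := fun t e => leftover t e * (arrival t e * services e t))
    (dependsOn_leftover_mul t), slotMean_add (dependsOn_arrival_mul_services_sq t),
    slotMean_add (f := fun _ _ => 1) (fun _ _ _ => rfl), slotMean_idle_sq, two_mul]
  have h1 := slotMean_leftover_mul (β := β) (σ := σ) (ν := ν) id t
  have h2 := slotMean_arrival_mul (β := β) (σ := σ) (ν := ν) (fun n => n ^ 2) t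
  simp only [id] at h1
  rw [h1, h2]

lemma sum_range_ite_zero_le (N : ℕ) (c : ℝ≥0∞) :
    ∑ n ∈ Finset.range N, (if n = 0 then c else 0) ≤ c := by
  rw [Finset.sum_ite_eq' (Finset.range N) 0 fun _ => c]
  split_ifs <;> simp

/-- Dropping the final workload, the balance bounds the truncated mean length by the mean vacation
plus `ρ` times itself. The truncation makes it finite, so it can be absorbed. This does not
presuppose that the cycle ends. -/
lemma tsum_slotMean_one_le (hV : ∀ᵐ n ∂ν, 1 ≤ n)
    (hρ : erate β * (∫⁻ n, (n : ℝ≥0∞) ∂σ) < 1) :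
    ∑' t, slotMean β σ ν (fun _ _ => 1) t ≤
      (∫⁻ n, (n : ℝ≥0∞) ∂ν) / (1 - erate β * (∫⁻ n, (n : ℝ≥0∞) ∂σ)) := by
  refine ENNReal.tsum_le_of_sum_range_le fun N => ?_
  refine le_div_of_le_mul_add (ne_top_of_le_ne_top (b := (N : ℝ≥0∞)) (by simp) ?_) hρ ?_
  · calc _ ≤ ∑ n ∈ Finset.range N, (1 : ℝ≥0∞) := Finset.sum_le_sum fun n _ => slotMean_one_le n
      _ = N := by simp
  · have := slotMean_balance (β := β) (σ := σ) (ν := ν) (w := work) (f := fun _ _ => 1)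
      (g := inflow) (N := N) (dependsOn_work' N) (fun _ _ _ _ => rfl) dependsOn_inflow (by
        filter_upwards [ae_one_le_vacations hV] with e he
        exact live_mul_work_add_sum he N)
    calc _ ≤ _ := le_add_self
      _ = _ := this
      _ = ∑ n ∈ Finset.range N, (if n = 0 then ∫⁻ n, (n : ℝ≥0∞) ∂ν else 0) +
          erate β * (∫⁻ n, (n : ℝ≥0∞) ∂σ) *
            ∑ n ∈ Finset.range N, slotMean β σ ν (fun _ _ => 1) n := by
        simp_rw [slotMean_inflow]
        rw [Finset.sum_add_distrib, Finset.mul_sum]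
      _ ≤ _ := by
        rw [add_comm]
        gcongr
        exact sum_range_ite_zero_le _ _

end Expectation

end BerGV

/-! ### Cycle means and the average workload -/

namespace BerGV

open Topology ENNReal

section CycleMeans

variable {β σ ν : Measure ℕ} [IsProbabilityMeasure β] [IsProbabilityMeasure σ]
  [IsProbabilityMeasure ν]

lemma slotMean_work_ne_top (hV : ∀ᵐ n ∂ν, 1 ≤ n) (hν : ∫⁻ n, (n : ℝ≥0∞) ∂ν ≠ ∞)
    (hρ : erate β * (∫⁻ n, (n : ℝ≥0∞) ∂σ) < 1) (N : ℕ) : slotMean β σ ν work N ≠ ∞ := by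
  have h1 := slotMean_balance (β := β) (σ := σ) (ν := ν) (w := work) (f := fun _ _ => 1)
    (g := inflow) (N := N) (dependsOn_work' N) (fun _ _ _ _ => rfl) dependsOn_inflow (by
      filter_upwards [ae_one_le_vacations hV] with e he
      exact live_mul_work_add_sum he N)
  refine ne_top_of_le_ne_top ?_ (le_self_add.trans h1.le)
  refine (ENNReal.sum_lt_top.2 fun n _ => ?_).ne
  rw [slotMean_inflow]
  refine ENNReal.add_lt_top.2 ⟨?_, ENNReal.mul_lt_top (hρ.trans one_lt_top)
    ((slotMean_one_le n).trans_lt one_lt_top)⟩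
  split_ifs
  · exact hν.lt_top
  · exact zero_lt_top

/-- Same absorption with the squared workload: twice the truncated workload sum is at most `ρ` times
itself plus a finite constant involving the second moments. -/
lemma tsum_slotMean_work_ne_top (hV : ∀ᵐ n ∂ν, 1 ≤ n) (hν : ∫⁻ n, (n : ℝ≥0∞) ∂ν ≠ ∞)
    (hν2 : ∫⁻ n, ((n ^ 2 : ℕ) : ℝ≥0∞) ∂ν ≠ ∞)
    (hρ : erate β * (∫⁻ n, (n : ℝ≥0∞) ∂σ) < 1)
    (hσ2 : erate β * (∫⁻ n, ((n ^ 2 : ℕ) : ℝ≥0∞) ∂σ) ≠ ∞) :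
    ∑' t, slotMean β σ ν work t ≠ ∞ := by
  set ρ := erate β * (∫⁻ n, (n : ℝ≥0∞) ∂σ) with hρdef
  set v := ∫⁻ n, (n : ℝ≥0∞) ∂ν with hv
  set P := ∑' t, slotMean β σ ν (fun _ _ => 1) t with hP
  have hρ1 : 1 - ρ ≠ 0 := (tsub_pos_of_lt hρ).ne'
  have hPtop : P ≠ ∞ := ne_top_of_le_ne_top (ENNReal.div_ne_top hν hρ1) (tsum_slotMean_one_le hV hρ)
  set c := 2 * ρ * v + (erate β * (∫⁻ n, ((n ^ 2 : ℕ) : ℝ≥0∞) ∂σ) * P +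
    (P + ∫⁻ n, ((n ^ 2 : ℕ) : ℝ≥0∞) ∂ν)) with hc
  have hctop : c ≠ ∞ := by
    have hρtop : ρ ≠ ∞ := (hρ.trans one_lt_top).ne
    refine ENNReal.add_ne_top.2 ⟨by finiteness, ENNReal.add_ne_top.2 ⟨by finiteness, by finiteness⟩⟩
  have hfin := slotMean_work_ne_top (β := β) (σ := σ) hV hν hρ
  refine ne_top_of_le_ne_top (ENNReal.div_ne_top hctop hρ1)
    (ENNReal.tsum_le_of_sum_range_le fun N => ?_)
  set a := ∑ n ∈ Finset.range N, slotMean β σ ν work n with ha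
  have hatop : a ≠ ∞ := (ENNReal.sum_lt_top.2 fun n _ => (hfin n).lt_top).ne
  have hone : ∑ n ∈ Finset.range N, slotMean β σ ν (fun _ _ => 1) n ≤ P := ENNReal.sum_le_tsum _
  have hy : ∑ n ∈ Finset.range N, slotMean β σ ν leftover n ≤ a + v := by
    calc _ ≤ ∑ n ∈ Finset.range N, (slotMean β σ ν work n + slotMean β σ ν idle n) :=
          Finset.sum_le_sum fun n _ =>
            le_self_add.trans (slotMean_leftover (ae_one_le_vacations hV) n).le
      _ ≤ a + v := by
          rw [Finset.sum_add_distrib]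
          gcongr
          simp_rw [slotMean_idle]
          exact sum_range_ite_zero_le _ _
  have hbal := slotMean_balance (β := β) (σ := σ) (ν := ν) (w := fun t e => work t e ^ 2)
    (f := outflowSq) (g := inflowSq) (N := N)
    (dependsOn_op (fun a _ => a ^ 2) (dependsOn_work' N) (dependsOn_work' N)) dependsOn_outflowSq
    dependsOn_inflowSq (by
      filter_upwards [ae_one_le_vacations hV] with e he
      exact live_mul_work_sq_add_sum he N)
  have h2a : 2 * a ≤ ρ * (2 * a) + c := by
    calc 2 * a ≤ ∑ n ∈ Finset.range N, slotMean β σ ν outflowSq n := by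
          rw [ha, Finset.mul_sum]
          refine Finset.sum_le_sum fun n _ => ?_
          rw [slotMean_outflowSq]
          gcongr
          exact le_self_add
      _ ≤ ∑ n ∈ Finset.range N, slotMean β σ ν inflowSq n := le_add_self.trans hbal.le
      _ = 2 * (ρ * ∑ n ∈ Finset.range N, slotMean β σ ν leftover n) +
          (erate β * (∫⁻ n, ((n ^ 2 : ℕ) : ℝ≥0∞) ∂σ) *
            ∑ n ∈ Finset.range N, slotMean β σ ν (fun _ _ => 1) n +
          (∑ n ∈ Finset.range N, slotMean β σ ν (fun _ _ => 1) n +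
            ∑ n ∈ Finset.range N, if n = 0 then ∫⁻ n, ((n ^ 2 : ℕ) : ℝ≥0∞) ∂ν else 0)) := by
          simp_rw [slotMean_inflowSq]
          rw [Finset.sum_add_distrib, Finset.sum_add_distrib, Finset.sum_add_distrib,
            Finset.mul_sum, Finset.mul_sum, Finset.mul_sum]
      _ ≤ 2 * (ρ * (a + v)) + (erate β * (∫⁻ n, ((n ^ 2 : ℕ) : ℝ≥0∞) ∂σ) * P +
          (P + ∫⁻ n, ((n ^ 2 : ℕ) : ℝ≥0∞) ∂ν)) := by
          gcongr
          exact sum_range_ite_zero_le _ _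
      _ = ρ * (2 * a) + c := by
          rw [hc]
          ring
  calc a ≤ 2 * a := le_mul_of_one_le_left zero_le one_le_two
    _ ≤ c / (1 - ρ) := le_div_of_le_mul_add (by finiteness) hρ h2a

/-- On an infinite cycle `live` is always 1, and its sum, of finite mean, would be infinite. -/
lemma ae_one_le_cycleLength (hP : ∑' t, slotMean β σ ν (fun _ _ => 1) t ≠ ∞) :
    ∀ᵐ e ∂(inputMeasure β σ ν), 1 ≤ cycleLength e := by
  unfold slotMean at hP
  rw [← lintegral_tsum fun t => (measurable_live_mul fun _ _ _ => rfl).aemeasurable] at hP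
  filter_upwards [ae_lt_top (Measurable.tsum fun t => measurable_live_mul fun _ _ _ => rfl) hP]
    with e he
  by_contra h
  have h1 : ∀ t, live t e = 1 := fun t => by
    have h2 : live t e ≠ 0 := fun h0 => h (one_le_cycleLength_of_live_eq_zero h0)
    have := live_le_one t e
    omega
  simp [h1] at he

/-- Evaluating the balance at the end of the cycle, where `live` vanishes, removes the boundary term
pathwise; no limit of its expectation is needed. -/
lemma tsum_slotMean_balance (hP : ∑' t, slotMean β σ ν (fun _ _ => 1) t ≠ ∞)
    {f g : ℕ → (Idx → ℕ) → ℕ} (w : ℕ → (Idx → ℕ) → ℕ)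
    (hf : ∀ t, DependsOn (f t) (past (t + 1))) (hg : ∀ t, DependsOn (g t) (past (t + 1)))
    (h : ∀ᵐ e ∂(inputMeasure β σ ν), ∀ N, live N e * w N e +
      ∑ n ∈ Finset.range N, live n e * f n e = ∑ n ∈ Finset.range N, live n e * g n e) :
    ∑' t, slotMean β σ ν f t = ∑' t, slotMean β σ ν g t := by
  have hfin := ae_one_le_cycleLength hP
  rw [← lintegral_cycleSum hfin hf, ← lintegral_cycleSum hfin hg]
  refine lintegral_congr_ae ?_
  filter_upwards [hfin, h] with e he h1
  have h2 := h1 (cycleLength e)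
  rw [live_eq_of_one_le he, if_neg (lt_irrefl _), zero_mul, zero_add] at h2
  rw [cycleSum_eq_sum_live he, cycleSum_eq_sum_live he, h2]

lemma integrable_cycleSum (hP : ∑' t, slotMean β σ ν (fun _ _ => 1) t ≠ ∞)
    {f : ℕ → (Idx → ℕ) → ℕ} (hf : ∀ t, DependsOn (f t) (past (t + 1)))
    (hfin : ∑' t, slotMean β σ ν f t ≠ ∞) :
    Integrable (fun e => (cycleSum f e : ℝ)) (inputMeasure β σ ν) ∧
      ∫ e, (cycleSum f e : ℝ) ∂(inputMeasure β σ ν) = (∑' t, slotMean β σ ν f t).toReal := by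
  rw [← lintegral_cycleSum (ae_one_le_cycleLength hP) hf] at hfin ⊢
  have hm : Measurable fun e => (cycleSum f e : ℝ) :=
    (measurable_of_countable (Nat.cast : ℕ → ℝ)).comp (measurable_cycleSum hf)
  constructor
  · refine ⟨hm.aestronglyMeasurable, ?_⟩
    rw [HasFiniteIntegral]
    simpa using hfin.lt_top
  · rw [integral_eq_lintegral_of_nonneg_ae (Eventually.of_forall fun _ => Nat.cast_nonneg _)
      hm.aestronglyMeasurable]
    simp

/-- `P`, `X` and `Y` are the cycle means of length, workload and leftover work. The second equation
gives `X - Y = P - v = r * P`; inserted in the third, `2 * (1 - r) * Y = (l - 1) * P + v2`, and `P *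
(1 - r) = v`. -/
lemma cycle_balance {P X Y v v2 r l : ℝ≥0∞} (hP : P ≠ ∞) (hX : X ≠ ∞) (hv : v ≠ ∞)
    (hv2 : v2 ≠ ∞) (hl : l ≠ ∞) (hr : r < 1) (hv1 : 1 ≤ v) (h1 : P = v + r * P)
    (h2 : Y + P = X + v) (h3 : 2 * (X + v) = 2 * (r * Y) + (l * P + (P + v2))) :
    X.toReal / P.toReal = Y.toReal / P.toReal + r.toReal ∧
    Y.toReal / P.toReal = (l.toReal - r.toReal) / (2 * (1 - r.toReal)) +
      v2.toReal / (2 * v.toReal) - 1 / 2 := by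
  have hY : Y ≠ ∞ := ne_top_of_le_ne_top (ENNReal.add_ne_top.2 ⟨hX, hv⟩) (h2 ▸ le_self_add)
  have hrt : r ≠ ∞ := (hr.trans one_lt_top).ne
  lift P to NNReal using hP
  lift X to NNReal using hX
  lift Y to NNReal using hY
  lift v to NNReal using hv
  lift v2 to NNReal using hv2
  lift l to NNReal using hl
  lift r to NNReal using hrt
  simp only [ENNReal.coe_toReal]
  have e1 : (P : ℝ) = v + r * P := by exact_mod_cast h1
  have e2 : (Y : ℝ) + P = X + v := by exact_mod_cast h2
  have e3 : 2 * ((X : ℝ) + v) = 2 * (r * Y) + (l * P + (P + v2)) := by exact_mod_cast h3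
  have e4 : (r : ℝ) < 1 := by exact_mod_cast hr
  have e5 : (1 : ℝ) ≤ v := by exact_mod_cast hv1
  have hr1 : 0 < 1 - (r : ℝ) := by linarith
  have hPv : (P : ℝ) = v / (1 - r) := by
    rw [eq_div_iff hr1.ne']
    linarith
  have hP0 : 0 < (P : ℝ) := by rw [hPv]; positivity
  have hv0 : (v : ℝ) = P * (1 - r) := by linarith
  refine ⟨?_, ?_⟩
  · rw [div_add' _ _ _ hP0.ne']
    congr 1
    linarith
  · have hYr : 2 * (1 - r) * (Y : ℝ) = (l - 1) * P + v2 := by linarith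
    have hY2 : (Y : ℝ) / P = ((l - 1) * P + v2) / (2 * (1 - r) * P) := by
      rw [← hYr]
      field_simp
    rw [hY2, hv0]
    field_simp
    ring

lemma toReal_lintegral_natCast {κ : Measure ℕ} (f : ℕ → ℕ) :
    (∫⁻ n, (f n : ℝ≥0∞) ∂κ).toReal = ∫ n, (f n : ℝ) ∂κ := by
  rw [integral_eq_lintegral_of_nonneg_ae (Eventually.of_forall fun _ => Nat.cast_nonneg _)
    (measurable_of_countable _).aestronglyMeasurable]
  simp

lemma lintegral_natCast_ne_top {κ : Measure ℕ} {f : ℕ → ℕ}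
    (hf : Integrable (fun n => (f n : ℝ)) κ) : ∫⁻ n, (f n : ℝ≥0∞) ∂κ ≠ ∞ := by
  have := hf.2
  rw [HasFiniteIntegral] at this
  simpa using this.ne

lemma toReal_erate {β : Measure ℕ} : (erate β).toReal = rate β := by
  refine (toReal_lintegral_natCast fun n => if n ≠ 0 then 1 else 0).trans ?_
  unfold rate
  refine integral_congr_ae (Eventually.of_forall fun n => ?_)
  simp

lemma erate_ne_top : erate β ≠ ∞ := by
  refine lintegral_natCast_ne_top (f := fun n => if n ≠ 0 then 1 else 0) ?_
  simpa using integrable_ite_ne_zero (β := β) 1 0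

/-- The time averages of the workload, and of the work that the arriving packets find. -/
theorem ae_meanTendsto_work (hσ : Integrable (fun n : ℕ => (n : ℝ) ^ 2) σ)
    (hν : Integrable (fun n : ℕ => (n : ℝ) ^ 2) ν) (hV : ∀ᵐ n ∂ν, 1 ≤ n)
    (hρ : rate β * ∫ n, (n : ℝ) ∂σ < 1) :
    ∃ y : ℝ, y = (rate β * ∫ n, (n : ℝ) ^ 2 ∂σ - rate β * ∫ n, (n : ℝ) ∂σ) /
        (2 * (1 - rate β * ∫ n, (n : ℝ) ∂σ)) +
        (∫ n, (n : ℝ) ^ 2 ∂ν) / (2 * ∫ n, (n : ℝ) ∂ν) - 1 / 2 ∧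
      (∀ᵐ e ∂(inputMeasure β σ ν), MeanTendsto (fun t => (work t e : ℝ))
        (y + rate β * ∫ n, (n : ℝ) ∂σ)) ∧
      ∀ᵐ e ∂(inputMeasure β σ ν), MeanTendsto (fun t => if arrivals e t then
        (afterSlot (workload (arrivals e) (services e) (vacations e) t) (vacations e t) : ℝ)
          else 0) (rate β * y) := by
  have hσ1 := (memLp_natCast hσ).integrable one_le_two
  have hν1 := (memLp_natCast hν).integrable one_le_two
  have tσ : ∫⁻ n, (n : ℝ≥0∞) ∂σ ≠ ∞ := lintegral_natCast_ne_top (f := id) hσ1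
  have tν : ∫⁻ n, (n : ℝ≥0∞) ∂ν ≠ ∞ := lintegral_natCast_ne_top (f := id) hν1
  have tσ2 : ∫⁻ n, ((n ^ 2 : ℕ) : ℝ≥0∞) ∂σ ≠ ∞ :=
    lintegral_natCast_ne_top (f := fun n => n ^ 2) (by simpa using hσ)
  have tν2 : ∫⁻ n, ((n ^ 2 : ℕ) : ℝ≥0∞) ∂ν ≠ ∞ :=
    lintegral_natCast_ne_top (f := fun n => n ^ 2) (by simpa using hν)
  have rσ : (∫⁻ n, (n : ℝ≥0∞) ∂σ).toReal = ∫ n, (n : ℝ) ∂σ := toReal_lintegral_natCast id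
  have rν : (∫⁻ n, (n : ℝ≥0∞) ∂ν).toReal = ∫ n, (n : ℝ) ∂ν := toReal_lintegral_natCast id
  have rσ2 : (∫⁻ n, ((n ^ 2 : ℕ) : ℝ≥0∞) ∂σ).toReal = ∫ n, (n : ℝ) ^ 2 ∂σ := by
    rw [toReal_lintegral_natCast fun n => n ^ 2]
    simp
  have rν2 : (∫⁻ n, ((n ^ 2 : ℕ) : ℝ≥0∞) ∂ν).toReal = ∫ n, (n : ℝ) ^ 2 ∂ν := by
    rw [toReal_lintegral_natCast fun n => n ^ 2]
    simp
  have hte := erate_ne_top (β := β)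
  have hρ' : erate β * (∫⁻ n, (n : ℝ≥0∞) ∂σ) < 1 := by
    rw [← ENNReal.toReal_lt_toReal (by finiteness) one_ne_top, ENNReal.toReal_mul, rσ,
      toReal_erate]
    simpa using hρ
  have hl : erate β * (∫⁻ n, ((n ^ 2 : ℕ) : ℝ≥0∞) ∂σ) ≠ ∞ := by finiteness
  have hP : ∑' t, slotMean β σ ν (fun _ _ => 1) t ≠ ∞ :=
    ne_top_of_le_ne_top (ENNReal.div_ne_top tν (tsub_pos_of_lt hρ').ne')
      (tsum_slotMean_one_le hV hρ')
  have hX : ∑' t, slotMean β σ ν work t ≠ ∞ := tsum_slotMean_work_ne_top hV tν tν2 hρ' hl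
  have hfin := ae_one_le_cycleLength hP
  have hite : ∀ c : ℝ≥0∞, ∑' t : ℕ, (if t = 0 then c else 0) = c := fun c =>
    tsum_ite_eq 0 fun _ => c
  have c1 : ∑' t, slotMean β σ ν (fun _ _ => 1) t = (∫⁻ n, (n : ℝ≥0∞) ∂ν) +
      erate β * (∫⁻ n, (n : ℝ≥0∞) ∂σ) * ∑' t, slotMean β σ ν (fun _ _ => 1) t := by
    refine (tsum_slotMean_balance hP work (fun _ _ _ _ => rfl) dependsOn_inflow ?_).trans ?_
    · filter_upwards [ae_one_le_vacations hV] with e he N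
      exact live_mul_work_add_sum he N
    · simp_rw [slotMean_inflow]
      rw [ENNReal.tsum_add, hite, ENNReal.tsum_mul_left]
  have c2 : ∑' t, slotMean β σ ν leftover t + ∑' t, slotMean β σ ν (fun _ _ => 1) t =
      ∑' t, slotMean β σ ν work t + ∫⁻ n, (n : ℝ≥0∞) ∂ν := by
    rw [← ENNReal.tsum_add]
    simp_rw [slotMean_leftover (ae_one_le_vacations hV), slotMean_idle]
    rw [ENNReal.tsum_add, hite]
  have c3 : 2 * (∑' t, slotMean β σ ν work t + ∫⁻ n, (n : ℝ≥0∞) ∂ν) =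
      2 * (erate β * (∫⁻ n, (n : ℝ≥0∞) ∂σ) * ∑' t, slotMean β σ ν leftover t) +
      (erate β * (∫⁻ n, ((n ^ 2 : ℕ) : ℝ≥0∞) ∂σ) * ∑' t, slotMean β σ ν (fun _ _ => 1) t +
      (∑' t, slotMean β σ ν (fun _ _ => 1) t + ∫⁻ n, ((n ^ 2 : ℕ) : ℝ≥0∞) ∂ν)) := by
    have h := tsum_slotMean_balance hP (fun t e => work t e ^ 2) dependsOn_outflowSq
      dependsOn_inflowSq (by
        filter_upwards [ae_one_le_vacations hV] with e he N
        exact live_mul_work_sq_add_sum he N)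
    simp_rw [slotMean_outflowSq, slotMean_inflowSq] at h
    rw [ENNReal.tsum_mul_left, ENNReal.tsum_add, ENNReal.tsum_add, ENNReal.tsum_add,
      ENNReal.tsum_add, hite, hite, ENNReal.tsum_mul_left, ENNReal.tsum_mul_left,
      ENNReal.tsum_mul_left] at h
    exact h
  have hv1 : 1 ≤ ∫⁻ n, (n : ℝ≥0∞) ∂ν := by
    calc (1 : ℝ≥0∞) = ∫⁻ _, 1 ∂ν := by simp
      _ ≤ _ := lintegral_mono_ae (by
        filter_upwards [hV] with n hn
        exact_mod_cast hn)
  obtain ⟨hx, hy⟩ := cycle_balance hP hX tν tν2 hl hρ' hv1 c1 c2 c3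
  simp only [ENNReal.toReal_mul, toReal_erate, rσ, rν, rσ2, rν2] at hx hy
  have iP := integrable_cycleSum hP (f := fun _ _ => 1) (fun _ _ _ _ => rfl) hP
  rw [← cycleLength_eq_cycleSum] at iP
  have iX := integrable_cycleSum hP dependsOn_work' hX
  refine ⟨_, hy, ?_, ?_⟩
  · have := ae_meanTendsto_of_cycleSum hfin iP.1 dependsOn_work'
      (fun e s t h => work_shift h t) iX.1
    rwa [iX.2, iP.2, hx] at this
  -- An arrival is independent of the leftover work, so arrivals see its time average: the factor is
  -- just the rate.
  · have hsl : ∀ t, slotMean β σ ν (fun t e => leftover t e * (arrival t e * 1)) t =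
        erate β * slotMean β σ ν leftover t := fun t => by
      rw [slotMean_leftover_mul fun _ => 1]
      simp
    have hY : ∑' t, slotMean β σ ν leftover t ≠ ∞ :=
      ne_top_of_le_ne_top (ENNReal.add_ne_top.2 ⟨hX, tν⟩) (c2 ▸ le_self_add)
    have hdep : ∀ t, DependsOn (fun e => leftover t e * (arrival t e * 1)) (past (t + 1)) :=
      fun t => dependsOn_op (fun a b => a * (b * 1)) (dependsOn_leftover' t) (dependsOn_arrival t)
    have htop : ∑' t, slotMean β σ ν (fun t e => leftover t e * (arrival t e * 1)) t ≠ ∞ := by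
      simp_rw [hsl]
      rw [ENNReal.tsum_mul_left]
      finiteness
    have iY := integrable_cycleSum hP hdep htop
    have := ae_meanTendsto_of_cycleSum hfin iP.1 hdep (fun e s t h => by
      unfold leftover
      rw [work_shift h]
      rfl) iY.1
    simp_rw [hsl] at iY
    rw [iY.2, iP.2, ENNReal.tsum_mul_left, ENNReal.toReal_mul, toReal_erate, mul_div_assoc] at this
    filter_upwards [this] with e he
    refine he.congr fun t => ?_
    simp only [arrivals_eq_true_iff, arrival, leftover]
    split_ifs
    · simp
      rfl
    · simp

end CycleMeans

end BerGV

/-! ### Assembly and transfer to the given probability space -/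

namespace BerGV

open Topology

/-- The peak age and the average age for the input sequence on its canonical space. -/
theorem ae_peakAge_averageAge {β σ ν : Measure ℕ} [IsProbabilityMeasure β]
    [IsProbabilityMeasure σ] [IsProbabilityMeasure ν] (a₀ : ℕ) (h0 : 0 < rate β)
    (hσ : Integrable (fun n : ℕ => (n : ℝ) ^ 2) σ) (hν : Integrable (fun n : ℕ => (n : ℝ) ^ 2) ν)
    (hσ1 : ∀ᵐ n ∂σ, 1 ≤ n) (hν1 : ∀ᵐ n ∂ν, 1 ≤ n) (hρ : rate β * ∫ n, (n : ℝ) ∂σ < 1) :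
    ∀ᵐ e ∂(inputMeasure β σ ν),
      peakAge (age (arrivals e) (services e) (vacations e) a₀) =
        ((1 / rate β + ∫ n, (n : ℝ) ∂σ + (rate β * ∫ n, (n : ℝ) ^ 2 ∂σ -
          rate β * ∫ n, (n : ℝ) ∂σ) / (2 * (1 - rate β * ∫ n, (n : ℝ) ∂σ)) +
          (∫ n, (n : ℝ) ^ 2 ∂ν) / (2 * ∫ n, (n : ℝ) ∂ν) - 1 / 2 : ℝ) : EReal) ∧
      averageAge (age (arrivals e) (services e) (vacations e) a₀) ≤
        peakAge (age (arrivals e) (services e) (vacations e) a₀) := by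
  have hs : 1 ≤ ∫ n, (n : ℝ) ∂σ := by
    calc (1 : ℝ) = ∫ _, 1 ∂σ := by simp
      _ ≤ _ := by
        refine integral_mono_ae (integrable_const _)
          ((memLp_natCast hσ).integrable one_le_two) ?_
        filter_upwards [hσ1] with n hn
        exact_mod_cast hn
  -- Services last at least one slot, so stability forces the rate below 1 and `q = 1 - rate β` is
  -- positive.
  have h1 : rate β < 1 := (le_mul_of_one_le_right h0.le hs).trans_lt hρ
  obtain ⟨y, hy, hW, hBY⟩ := ae_meanTendsto_work (β := β) hσ hν hν1 hρ
  obtain ⟨c, hc, hXV⟩ := ae_meanTendsto_since_vacation a₀ h0 h1 hσ hν hν1 hρ hW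
  filter_upwards [hW, hBY, hXV, ae_one_le_services hσ1, ae_one_le_vacations hν1,
    ae_tendsto_since_div a₀ h0 h1.le, ae_meanTendsto_arrival h0 h1.le,
    ae_meanTendsto_arrival_service h0 h1.le hσ,
    ae_meanTendsto_since_service a₀ h0 h1.le hσ] with e g1 g2 g3 g4 g5 g6 g7 g8 g9
  have hpeak := peakAge_eq g4 g5 a₀ h0 g7 g8 g2 g6
  rw [mul_div_cancel_left₀ _ h0.ne'] at hpeak
  refine ⟨?_, ?_⟩
  · rw [hpeak, hy, EReal.coe_eq_coe_iff]
    ring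
  · rw [hpeak]
    -- The bound is `c + (y + r) + E[S]` with `r` the load; `c ≤ 1 / rate β - r` makes `r` cancel.
    refine (averageAge_le g4 g5 a₀ g1 g6 g9 g3).trans (EReal.coe_le_coe_iff.2 ?_)
    linarith

/-- The joint law of the random input. -/
lemma IsInput.map_eq_inputMeasure {Ω : Type*} [MeasurableSpace Ω] {P : Measure Ω}
    [IsProbabilityMeasure P] {lam : ℝ} {B : ℕ → Ω → Bool} {S V : ℕ → Ω → ℕ}
    (h : IsInput P lam B S V) [IsProbabilityMeasure (P.map fun ω => (B 0 ω).toNat)]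
    [IsProbabilityMeasure (P.map (S 0))] [IsProbabilityMeasure (P.map (V 0))] :
    P.map (fun ω i => (Sum.elim (fun t ω => (B t ω).toNat) (Sum.elim S V) : Idx → Ω → ℕ) i ω) =
      inputMeasure (P.map fun ω => (B 0 ω).toNat) (P.map (S 0)) (P.map (V 0)) := by
  have hB : ∀ t, Measurable fun ω => (B t ω).toNat := fun t =>
    (measurable_of_countable Bool.toNat).comp (h.measurable_B t)
  have hm : ∀ i, Measurable
      ((Sum.elim (fun t ω => (B t ω).toNat) (Sum.elim S V) : Idx → Ω → ℕ) i) := by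
    rintro (t | t | t)
    · exact hB t
    · exact h.measurable_S t
    · exact h.measurable_V t
  rw [h.indep.map_fun_eq_infinitePi_map hm]
  unfold inputMeasure
  congr 1
  funext i
  rcases i with t | t | t
  · have htrue : P (B t ⁻¹' {true}) = P (B 0 ⁻¹' {true}) := by
      have h1 := (h.prob_B t).trans (h.prob_B 0).symm
      exact (measureReal_eq_measureReal_iff (by finiteness) (by finiteness)).1 h1
    have hfalse : P (B t ⁻¹' {false}) = P (B 0 ⁻¹' {false}) := by
      have hcompl : ∀ s, B s ⁻¹' {false} = (B s ⁻¹' {true})ᶜ := fun s => by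
        ext ω
        simp
      rw [hcompl, hcompl, prob_compl_eq_one_sub (h.measurable_B t (measurableSet_singleton _)),
        prob_compl_eq_one_sub (h.measurable_B 0 (measurableSet_singleton _)), htrue]
    have hlaw : P.map (B t) = P.map (B 0) := by
      refine Measure.ext_of_singleton fun b => ?_
      rw [Measure.map_apply (h.measurable_B t) (measurableSet_singleton _),
        Measure.map_apply (h.measurable_B 0) (measurableSet_singleton _)]
      cases b
      · exact hfalse
      · exact htrue
    have hcomp : ∀ s, P.map (fun ω => (B s ω).toNat) = (P.map (B s)).map Bool.toNat := fun s =>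
      (Measure.map_map (measurable_of_countable Bool.toNat) (h.measurable_B s)).symm
    simp only [Sum.elim_inl, inputLaw]
    rw [hcomp, hcomp, hlaw]
  · exact (h.identDistrib_S t).map_eq
  · exact (h.identDistrib_V t).map_eq

end BerGV

theorem theorem2 {Ω : Type*} [MeasurableSpace Ω] (P : Measure Ω) [IsProbabilityMeasure P]
    (lam μ ρ : ℝ) (B : ℕ → Ω → Bool) (S V : ℕ → Ω → ℕ) (a₀ : ℕ)
    (hinput : BerGV.IsInput P lam B S V)
    (hlam : 0 < lam)
    (hS : ∫ ω, (S 0 ω : ℝ) ∂P = 1 / μ)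
    (hρ : ρ = lam / μ) (hstable : ρ < 1)
    (hS2 : Integrable (fun ω => (S 0 ω : ℝ) ^ 2) P)
    (hV2 : Integrable (fun ω => (V 0 ω : ℝ) ^ 2) P) :
    ∀ᵐ ω ∂P,
      BerGV.peakAge (BerGV.age (B · ω) (S · ω) (V · ω) a₀) =
        ((1 / lam + 1 / μ + (lam * (∫ ω', (S 0 ω' : ℝ) ^ 2 ∂P) - ρ) / (2 * (1 - ρ))
          + (∫ ω', (V 0 ω' : ℝ) ^ 2 ∂P) / (2 * ∫ ω', (V 0 ω' : ℝ) ∂P) - 1 / 2 : ℝ) : EReal) ∧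
      BerGV.averageAge (BerGV.age (B · ω) (S · ω) (V · ω) a₀) ≤
        BerGV.peakAge (BerGV.age (B · ω) (S · ω) (V · ω) a₀) := by
  have hBm : Measurable fun ω => (B 0 ω).toNat :=
    (measurable_of_countable Bool.toNat).comp (hinput.measurable_B 0)
  have hSm := hinput.measurable_S 0
  have hVm := hinput.measurable_V 0
  have : IsProbabilityMeasure (P.map fun ω => (B 0 ω).toNat) :=
    Measure.isProbabilityMeasure_map hBm.aemeasurable
  have : IsProbabilityMeasure (P.map (S 0)) := Measure.isProbabilityMeasure_map hSm.aemeasurable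
  have : IsProbabilityMeasure (P.map (V 0)) := Measure.isProbabilityMeasure_map hVm.aemeasurable
  have hrate : BerGV.rate (P.map fun ω => (B 0 ω).toNat) = lam := by
    rw [BerGV.rate, integral_map hBm.aemeasurable
      (measurable_of_countable _).aestronglyMeasurable, ← hinput.prob_B 0]
    have h1 : (fun ω => if (B 0 ω).toNat ≠ 0 then (1 : ℝ) else 0) =
        Set.indicator {ω | B 0 ω = true} 1 := by
      funext ω
      cases hb : B 0 ω <;> simp [Set.indicator, hb]
    have hset : MeasurableSet {ω | B 0 ω = true} :=
      hinput.measurable_B 0 (measurableSet_singleton true)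
    rw [h1]
    exact integral_indicator_one hset
  have hmapS : ∀ f : ℕ → ℝ, ∫ n, f n ∂(P.map (S 0)) = ∫ ω, f (S 0 ω) ∂P := fun f =>
    integral_map hSm.aemeasurable (measurable_of_countable _).aestronglyMeasurable
  have hmapV : ∀ f : ℕ → ℝ, ∫ n, f n ∂(P.map (V 0)) = ∫ ω, f (V 0 ω) ∂P := fun f =>
    integral_map hVm.aemeasurable (measurable_of_countable _).aestronglyMeasurable
  have hlamS : lam * (1 / μ) = ρ := by rw [hρ, mul_one_div]
  have hS2' : Integrable (fun n : ℕ => (n : ℝ) ^ 2) (P.map (S 0)) :=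
    (integrable_map_measure (measurable_of_countable _).aestronglyMeasurable hSm.aemeasurable).2 hS2
  have hV2' : Integrable (fun n : ℕ => (n : ℝ) ^ 2) (P.map (V 0)) :=
    (integrable_map_measure (measurable_of_countable _).aestronglyMeasurable hVm.aemeasurable).2 hV2
  have key := BerGV.ae_peakAge_averageAge (β := P.map fun ω => (B 0 ω).toNat) (σ := P.map (S 0))
    (ν := P.map (V 0)) a₀ (by rwa [hrate]) hS2' hV2'
    ((ae_map_iff hSm.aemeasurable (MeasurableSet.of_discrete)).2 (hinput.one_le_S 0))
    ((ae_map_iff hVm.aemeasurable (MeasurableSet.of_discrete)).2 (hinput.one_le_V 0))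
    (by rw [hrate, hmapS (fun n => n), hS, hlamS]; exact hstable)
  rw [hrate, hmapS (fun n => n), hmapS (fun n => (n : ℝ) ^ 2), hmapV (fun n => n),
    hmapV (fun n => (n : ℝ) ^ 2), hS, hlamS, ← hinput.map_eq_inputMeasure] at key
  have hm : Measurable fun ω i =>
      (Sum.elim (fun t ω => (B t ω).toNat) (Sum.elim S V) : BerGV.Idx → Ω → ℕ) i ω := by
    refine measurable_pi_lambda _ ?_
    rintro (t | t | t)
    · exact (measurable_of_countable Bool.toNat).comp (hinput.measurable_B t)
    · exact hinput.measurable_S t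
    · exact hinput.measurable_V t
  -- The two ages are functions of the input sequence, whose law is `inputMeasure`, so the almost
  -- sure statement pulls back.
  filter_upwards [ae_of_ae_map hm.aemeasurable key] with ω hω
  have harr : BerGV.arrivals (fun i =>
      (Sum.elim (fun t ω => (B t ω).toNat) (Sum.elim S V) : BerGV.Idx → Ω → ℕ) i ω) =
      fun t => B t ω := by
    funext t
    simp only [BerGV.arrivals, Sum.elim_inl]
    cases B t ω <;> rfl
  rw [harr] at hω
  exact hω
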